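/- All Banach spaces are over $\mathbb{R}$. For metric spaces $X,Y$ let $e(X,Y)\in[0,\infty]$ be the least constant (infimum) $K$ such that for every subset $Z\subseteq X$ every Lipschitz map $f:Z\to Y$ extends to a map $\tilde f:X\to Y$ with $\|\tilde f\|_{\mathrm{Lip}}\le K\|f\|_{\mathrm{Lip}}$ ($e(X,Y)=\infty$ if there is no such $K$). For a Banach space $X$ let $S_2(X)\in[0,\infty]$ be the infimum of all $S>0$ such that $$\|x+y\|^2+\|x-y\|^2\le 2\|x\|^2+2S^2\|y\|^2\qquad\text{for all }x,y\in X,$$ and let $K_2(X)\in[0,\infty]$ be the infimum of all $K>0$ such that $$2\|x\|^2+\frac{2}{K^2}\|y\|^2\le \|x+y\|^2+\|x-y\|^2\qquad\text{for all }x,y\in X$$ (infima of empty sets are $\infty$, and $0\cdot\infty=0$). Let $$\rho_X(\tau)=\sup\Bigl\{\tfrac{\|x+\tau y\|+\|x-\tau y\|}{2}-1:\ \|x\|=\|y\|=1\Bigr\},\qquad \delta_X(\varepsilon)=\inf\Bigl\{1-\tfrac{\|x+y\|}{2}:\ \|x\|=\|y\|=1,\ \|x-y\|=\varepsilon\Bigr\}.$$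 We say that $X$ has modulus of smoothness of power type $2$ if there is a constant $K$ with $\rho_X(\tau)\le K\tau^2$ for all $\tau>0$, and that $X$ has modulus of convexity of power type $2$ if there is a constant $c>0$ with $\delta_X(\varepsilon)\ge c\,\varepsilon^2$ for all $\varepsilon\in[0,2]$ (the supremum and infimum of the empty set being $-\infty$ and $+\infty$). **Theorem.** 1. For all Banach spaces $X,Y$, $$e(X,Y)\le 24\,S_2(X)\,K_2(Y).$$ Moreover, if $S_2(X)$ and $K_2(Y)$ are finite, then every Lipschitz map $f:Z\to Y$ on a subset $Z\subseteq X$ has an extension $\tilde f:X\to Y$ with $\|\tilde f\|_{\mathrm{Lip}}\le 24\,S_2(X)K_2(Y)\|f\|_{\mathrm{Lip}}$. 2. If $X$ is a Banach space with modulus of smoothness of power type $2$ and $Y$ is a Banach space with modulus of convexity of power type $2$, then there is a constant $C=C(X,Y)<\infty$ such that for every $A\subseteq X$ every Lipschitz map $f:A\to Y$ extends to $\tilde f:X\to Y$ with $\|\tilde f\|_{\mathrm{Lip}}\le C\|f\|_{\mathrm{Lip}}$. 3. For $2\le p<\infty$ and $1<q\le 2$, and arbitrary measures $\mu,\nu$,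 $$e(L_p(\mu),L_q(\nu))\le 24\sqrt{\frac{p-1}{q-1}}.$$ -/

import Mathlib

open scoped NNReal ENNReal

noncomputable section

/-- Every `L`-Lipschitz map from a subset of `X` to `Y` extends to a `K * L`-Lipschitz map
defined on all of `X`. -/
def LipschitzExtends (X Y : Type*) [MetricSpace X] [MetricSpace Y] (K : ℝ≥0) : Prop :=
  ∀ (Z : Set X) (f : Z → Y) (L : ℝ≥0), LipschitzWith L f →
    ∃ g : X → Y, LipschitzWith (K * L) g ∧ ∀ z : Z, g z = f z

/-- The Lipschitz extension constant `e(X, Y)`; it is `∞` if no constant works. -/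
def extensionConstant (X Y : Type*) [MetricSpace X] [MetricSpace Y] : ℝ≥0∞ :=
  ⨅ (K : ℝ≥0) (_ : LipschitzExtends X Y K), (K : ℝ≥0∞)

/-- The `p`-smoothness constant `S_p(X)`; it is `∞` if no constant works. -/
def smoothnessConstant (p : ℝ) (X : Type*) [NormedAddCommGroup X] [NormedSpace ℝ X] : ℝ≥0∞ :=
  ⨅ (S : ℝ≥0) (_ : 0 < S ∧ ∀ x y : X,
    ‖x + y‖ ^ p + ‖x - y‖ ^ p ≤ 2 * ‖x‖ ^ p + 2 * (S : ℝ) ^ p * ‖y‖ ^ p), (S : ℝ≥0∞)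

/-- The `q`-convexity constant `K_q(X)`; it is `∞` if no constant works. -/
def convexityConstant (q : ℝ) (X : Type*) [NormedAddCommGroup X] [NormedSpace ℝ X] : ℝ≥0∞ :=
  ⨅ (K : ℝ≥0) (_ : 0 < K ∧ ∀ x y : X,
    2 * ‖x‖ ^ q + 2 / (K : ℝ) ^ q * ‖y‖ ^ q ≤ ‖x + y‖ ^ q + ‖x - y‖ ^ q), (K : ℝ≥0∞)

/-- The modulus of uniform convexity `δ_X(ε)`. It takes values in the extended reals, so that the
infimum of the empty set (which occurs in dimension at most one) is `+∞`. -/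
def convexityModulus (X : Type*) [NormedAddCommGroup X] [NormedSpace ℝ X] (ε : ℝ) : EReal :=
  ⨅ (x : X) (y : X) (_ : ‖x‖ = 1 ∧ ‖y‖ = 1 ∧ ‖x - y‖ = ε), ((1 - ‖x + y‖ / 2 : ℝ) : EReal)

/-- The modulus of uniform smoothness `ρ_X(τ)`, with values in the extended reals. -/
def smoothnessModulus (X : Type*) [NormedAddCommGroup X] [NormedSpace ℝ X] (τ : ℝ) : EReal :=
  ⨆ (x : X) (y : X) (_ : ‖x‖ = 1 ∧ ‖y‖ = 1),
    (((‖x + τ • y‖ + ‖x - τ • y‖) / 2 - 1 : ℝ) : EReal)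

/-- `X` has modulus of convexity of power type `q`. -/
def HasConvexityPowerType (q : ℝ) (X : Type*) [NormedAddCommGroup X] [NormedSpace ℝ X] : Prop :=
  ∃ c : ℝ, 0 < c ∧ ∀ ε ∈ Set.Icc (0 : ℝ) 2, ((c * ε ^ q : ℝ) : EReal) ≤ convexityModulus X ε

/-- `X` has modulus of smoothness of power type `p`. -/
def HasSmoothnessPowerType (p : ℝ) (X : Type*) [NormedAddCommGroup X] [NormedSpace ℝ X] : Prop :=
  ∃ K : ℝ, ∀ τ : ℝ, 0 < τ → smoothnessModulus X τ ≤ ((K * τ ^ p : ℝ) : EReal)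

end

/-!
Let `X` be `2`-smooth with constant `S` and `Y` be `2`-convex with constant `K`. By a minimax
argument (`exists_forall_lt_of_forall_sum_le`) it is enough to extend a Lipschitz map to finitely
many further points so that a weighted sum of squared distances, with arbitrary positive weights,
is at most a constant times the same sum in `X`; weak limits along an ultrafilter
(`exists_weak_limit`) then give the extension to all of `X`.

The weights define a reversible Markov chain on the new points, killed at unit rate with exit into
the domain of the map, and the extension used is the harmonic one: the expectation of the map at
the exit point. Its values along the chain form a martingale. As `Y` is `2`-convex, the quadratic
variation of that martingale, which is the energy to be bounded, is controlled by the mean square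
distance of the two ends of the trajectory started from the boundary
(`exists_harmonic_extension`). By the Lipschitz property this distance may be measured in `X`,
where Markov type `2` (`markovType_two_of_smooth`) bounds it by the energy in `X`. Markov type `2`
of a `2`-smooth space holds because the displacement of a reversible chain is half the difference of
a forward and a backward martingale, up to boundary terms, and a martingale in a `2`-smooth space
has mean square at most a constant times the sum of those of its increments. The energy bound
`108 S² K²` obtained in this way is less than `(24 S K)²`, with room to spare.

Moduli of power type `2` give finite constants by a direct computation with the norm. For `L_p` the
constants come from the inequality `(a² + (q - 1) b²)^(q/2) ≤ (|a + b|^q + |a - b|^q) / 2` for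
`1 < q ≤ 2` (`rpow_le_avg_rpow`) and from its dual for `2 ≤ p` (`avg_rpow_le_rpow`), integrated.
-/

/-! ### Two-point inequalities and barycentres -/

section Barycentre

variable {E : Type*} [NormedAddCommGroup E] [NormedSpace ℝ E] {κ : Type*} [Fintype κ]

/-- Jensen's inequality for the squared norm. -/
lemma sq_norm_sum_smul_le {p : κ → ℝ} (hp : ∀ k, 0 ≤ p k) (hp1 : ∑ k, p k = 1) (z : κ → E) :
    ‖∑ k, p k • z k‖ ^ 2 ≤ ∑ k, p k * ‖z k‖ ^ 2 := by
  have h := (convexOn_univ_norm (E := E)).pow (fun _ _ => norm_nonneg _) 2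
  simpa using h.map_sum_le (t := Finset.univ) (fun i _ => hp i) hp1 (fun i _ => Set.mem_univ (z i))

/-- In a `2`-smooth space, a mean-zero perturbation `D` increases the mean square of the norm by
at most `2 S²` times the mean square of `D`. -/
lemma sum_sq_norm_add_le_of_smooth {S : ℝ}
    (hS : ∀ x y : E, ‖x + y‖ ^ 2 + ‖x - y‖ ^ 2 ≤ 2 * ‖x‖ ^ 2 + 2 * S ^ 2 * ‖y‖ ^ 2)
    {p : κ → ℝ} (hp : ∀ k, 0 ≤ p k) (hp1 : ∑ k, p k = 1) (v : E) (D : κ → E)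
    (hD : ∑ k, p k • D k = 0) :
    ∑ k, p k * ‖v + D k‖ ^ 2 ≤ ‖v‖ ^ 2 + 2 * S ^ 2 * ∑ k, p k * ‖D k‖ ^ 2 := by
  have h1 : ∑ k, p k * (‖v + D k‖ ^ 2 + ‖v - D k‖ ^ 2) ≤
      ∑ k, p k * (2 * ‖v‖ ^ 2 + 2 * S ^ 2 * ‖D k‖ ^ 2) :=
    Finset.sum_le_sum fun k _ => mul_le_mul_of_nonneg_left (hS v (D k)) (hp k)
  have h2 : ‖v‖ ^ 2 ≤ ∑ k, p k * ‖v - D k‖ ^ 2 := by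
    have h := sq_norm_sum_smul_le hp hp1 (fun k => v - D k)
    simpa [smul_sub, Finset.sum_sub_distrib, hD, ← Finset.sum_smul, hp1] using h
  have h3 : ∑ k, p k * (2 * ‖v‖ ^ 2 + 2 * S ^ 2 * ‖D k‖ ^ 2) =
      2 * ‖v‖ ^ 2 + 2 * S ^ 2 * ∑ k, p k * ‖D k‖ ^ 2 := by
    simp only [mul_add, Finset.sum_add_distrib, ← Finset.sum_mul, hp1, Finset.mul_sum]
    congr 1
    · ring
    · exact Finset.sum_congr rfl fun k _ => by ring
  simp only [mul_add, Finset.sum_add_distrib] at h1 h3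
  linarith

/-- In a `2`-convex space, the mean square of the norm exceeds the square of the norm of the
mean by a multiple of the variance. -/
lemma sq_norm_add_variance_le_of_convex {c : ℝ}
    (hc : ∀ x y : E, 2 * ‖x‖ ^ 2 + 2 * c * ‖y‖ ^ 2 ≤ ‖x + y‖ ^ 2 + ‖x - y‖ ^ 2)
    {p : κ → ℝ} (hp : ∀ k, 0 ≤ p k) (hp1 : ∑ k, p k = 1) (z : κ → E) (m : E)
    (hm : ∑ k, p k • z k = m) :
    ‖m‖ ^ 2 + c / 2 * ∑ k, p k * ‖z k - m‖ ^ 2 ≤ ∑ k, p k * ‖z k‖ ^ 2 := by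
  have h0 (k : κ) : 2 * ‖(2⁻¹ : ℝ) • (z k + m)‖ ^ 2 + c / 2 * ‖z k - m‖ ^ 2 ≤
      ‖z k‖ ^ 2 + ‖m‖ ^ 2 := by
    have h := hc ((2⁻¹ : ℝ) • (z k + m)) ((2⁻¹ : ℝ) • (z k - m))
    have e1 : (2⁻¹ : ℝ) • (z k + m) + (2⁻¹ : ℝ) • (z k - m) = z k := by module
    have e2 : (2⁻¹ : ℝ) • (z k + m) - (2⁻¹ : ℝ) • (z k - m) = m := by module
    rw [e1, e2, norm_smul (2⁻¹ : ℝ) (z k - m), mul_pow] at h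
    norm_num at h ⊢
    linarith
  have h1 := Finset.sum_le_sum fun k (_ : k ∈ Finset.univ) =>
    mul_le_mul_of_nonneg_left (h0 k) (hp k)
  have h2 : ‖m‖ ^ 2 ≤ ∑ k, p k * ‖(2⁻¹ : ℝ) • (z k + m)‖ ^ 2 := by
    have h := sq_norm_sum_smul_le hp hp1 (fun k => (2⁻¹ : ℝ) • (z k + m))
    have e : ∑ k, p k • (2⁻¹ : ℝ) • (z k + m) = m := by
      simp only [smul_comm _ (2⁻¹ : ℝ), ← Finset.smul_sum, smul_add, Finset.sum_add_distrib,
        ← Finset.sum_smul, hp1, hm]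
      module
    rwa [e] at h
  simp only [mul_add, Finset.sum_add_distrib, ← Finset.sum_mul, hp1, one_mul] at h1
  simp only [mul_left_comm (p _), ← Finset.mul_sum] at h1
  linarith

end Barycentre

/-! ### Additive functionals of a reversible Markov chain -/

section Markov

variable {E : Type*} [AddCommGroup E] {ι : Type*} [Fintype ι]

/-- The expectation of `g (X_t) (θ + ∑_{s < t} (d (X_s) + d (X_{s+1})))` for the chain `X` with
transition matrix `A` started at `X_0 = i`. The additive functional counts every step
symmetrically, so that it is unchanged when the trajectory is reversed. -/
def pathSum (A : Matrix ι ι ℝ) (d : ι → E) : ℕ → (ι → E → ℝ) → ι → E → ℝ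
  | 0, g => g
  | t + 1, g => fun i θ => ∑ j, A i j * pathSum A d t g j (θ + d i + d j)

variable {A : Matrix ι ι ℝ} {d : ι → E}

lemma pathSum_mono (hA : ∀ i j, 0 ≤ A i j) (t : ℕ) {g h : ι → E → ℝ} (hgh : ∀ j θ, g j θ ≤ h j θ)
    (i : ι) (θ : E) : pathSum A d t g i θ ≤ pathSum A d t h i θ := by
  induction t generalizing i θ with
  | zero => exact hgh i θ
  | succ t ih => exact Finset.sum_le_sum fun j _ => mul_le_mul_of_nonneg_left (ih _ _) (hA i j)

lemma pathSum_sum {κ : Type*} (s : Finset κ) (t : ℕ) (c : κ → ℝ) (G : κ → ι → E → ℝ) (i : ι)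
    (θ : E) : pathSum A d t (fun j θ => ∑ k ∈ s, c k * G k j θ) i θ =
      ∑ k ∈ s, c k * pathSum A d t (G k) i θ := by
  induction t generalizing i θ with
  | zero => rfl
  | succ t ih =>
    simp only [pathSum, ih, Finset.mul_sum]
    rw [Finset.sum_comm]
    exact Finset.sum_congr rfl fun k _ => Finset.sum_congr rfl fun j _ => by ring

lemma pathSum_add (t : ℕ) (g h : ι → E → ℝ) (i : ι) (θ : E) :
    pathSum A d t (fun j θ => g j θ + h j θ) i θ =
      pathSum A d t g i θ + pathSum A d t h i θ := by
  simpa using pathSum_sum (A := A) (d := d) Finset.univ t (fun _ : Bool => 1)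
    (fun b => bif b then g else h) i θ

lemma pathSum_const_mul (t : ℕ) (c : ℝ) (g : ι → E → ℝ) (i : ι) (θ : E) :
    pathSum A d t (fun j θ => c * g j θ) i θ = c * pathSum A d t g i θ := by
  simpa using pathSum_sum (A := A) (d := d) Finset.univ t (fun _ : Unit => c) (fun _ => g) i θ

lemma pathSum_translate (t : ℕ) (τ : E) (g : ι → E → ℝ) (i : ι) (θ : E) :
    pathSum A d t (fun j θ => g j (θ + τ)) i θ = pathSum A d t g i (θ + τ) := by
  induction t generalizing i θ with
  | zero => rfl
  | succ t ih =>
    simp only [pathSum, ih]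
    exact Finset.sum_congr rfl fun j _ => by congr 2; abel

lemma pathSum_succ' (t : ℕ) (g : ι → E → ℝ) (i : ι) (θ : E) :
    pathSum A d (t + 1) g i θ =
      pathSum A d t (fun j θ => ∑ k, A j k * g k (θ + d j + d k)) i θ := by
  induction t generalizing i θ with
  | zero => rfl
  | succ t ih =>
    rw [pathSum]
    simp only [ih]
    rfl

/-- A functional that ignores the additive part is a power of the transition matrix. -/
lemma pathSum_const [DecidableEq ι] (t : ℕ) (h : ι → ℝ) (i : ι) (θ : E) :
    pathSum A d t (fun j _ => h j) i θ = ∑ j, (A ^ t) i j * h j := by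
  induction t generalizing i θ with
  | zero => simp [pathSum, Matrix.one_apply]
  | succ t ih =>
    simp only [pathSum, ih, pow_succ', Matrix.mul_apply, Finset.sum_mul, Finset.mul_sum]
    rw [Finset.sum_comm]
    simp only [mul_assoc]

/-- Reversibility: exchanging the two endpoints of the stationary trajectory does not change
expectations, even jointly with the additive functional. -/
lemma pathSum_reverse {π : ι → ℝ} (hrev : ∀ i j, π i * A i j = π j * A j i) (t : ℕ)
    (G : ι → ι → E → ℝ) :
    ∑ i, π i * pathSum A d t (G i) i 0 =
      ∑ j, π j * pathSum A d t (fun i θ => G i j θ) j 0 := by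
  induction t generalizing G with
  | zero => rfl
  | succ t ih =>
    have h := ih (fun k j θ => ∑ i, A k i * G i j (θ + (d k + d i)))
    calc ∑ i, π i * pathSum A d (t + 1) (G i) i 0
        = ∑ i, ∑ k, π k * A k i * pathSum A d t (G i) k (0 + (d k + d i)) := by
          simp only [pathSum, Finset.mul_sum]
          refine Finset.sum_congr rfl fun i _ => Finset.sum_congr rfl fun k _ => ?_
          rw [← mul_assoc, hrev i k]
          congr 2
          abel
      _ = ∑ k, π k * pathSum A d t
            (fun j θ => ∑ i, A k i * G i j (θ + (d k + d i))) k 0 := by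
          rw [Finset.sum_comm]
          refine Finset.sum_congr rfl fun k _ => ?_
          rw [pathSum_sum Finset.univ t (A k) (fun i j θ => G i j (θ + (d k + d i))),
            Finset.mul_sum]
          refine Finset.sum_congr rfl fun i _ => ?_
          rw [pathSum_translate t (d k + d i) (G i), mul_assoc]
      _ = _ := by
          rw [h]
          refine Finset.sum_congr rfl fun j _ => ?_
          rw [pathSum_succ']
          simp only [add_assoc]

end Markov

/-! ### Markov type `2` of smooth spaces -/

lemma sq_norm_add_le {E : Type*} [SeminormedAddCommGroup E] (x y : E) :
    ‖x + y‖ ^ 2 ≤ 2 * ‖x‖ ^ 2 + 2 * ‖y‖ ^ 2 := by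
  have h := pow_le_pow_left₀ (norm_nonneg _) (norm_add_le x y) 2
  nlinarith [sq_nonneg (‖x‖ - ‖y‖)]

section MarkovType

variable {E : Type*} [NormedAddCommGroup E] [NormedSpace ℝ E] {ι : Type*} [Fintype ι]
  {A : Matrix ι ι ℝ} {π : ι → ℝ}

/-- The forward martingale estimate. With `d` the drift of `x (X_s)`, the process
`2 (x (X_t) - c) - θ + d (X_t)` is a martingale along the chain, whose increments are
`2 (x (X_{s+1}) - x (X_s) - d (X_s))`. -/
lemma pathSum_sq_norm_le [DecidableEq ι] {S : ℝ}
    (hS : ∀ x y : E, ‖x + y‖ ^ 2 + ‖x - y‖ ^ 2 ≤ 2 * ‖x‖ ^ 2 + 2 * S ^ 2 * ‖y‖ ^ 2)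
    (hA : ∀ i j, 0 ≤ A i j) (hA1 : ∀ i, ∑ j, A i j = 1) (x d : ι → E)
    (hd : ∀ i, ∑ j, A i j • (x j - x i) = d i) (c : E) (t : ℕ) (i : ι) (θ : E) :
    pathSum A d t (fun j θ => ‖(2 : ℝ) • (x j - c) - θ + d j‖ ^ 2) i θ ≤
      ‖(2 : ℝ) • (x i - c) - θ + d i‖ ^ 2 +
        8 * S ^ 2 * ∑ s ∈ Finset.range t,
          ∑ k, (A ^ s) i k * ∑ j, A k j * ‖x j - x k - d k‖ ^ 2 := by
  induction t generalizing i θ with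
  | zero => simp [pathSum]
  | succ t ih =>
    set e : ι → ℝ := fun k => ∑ j, A k j * ‖x j - x k - d k‖ ^ 2 with he
    have h1 : ∑ j, A i j * ‖(2 : ℝ) • (x j - c) - (θ + d i + d j) + d j‖ ^ 2 ≤
        ‖(2 : ℝ) • (x i - c) - θ + d i‖ ^ 2 + 8 * S ^ 2 * e i := by
      have hD : ∑ j, A i j • ((2 : ℝ) • (x j - x i - d i)) = 0 := by
        have h0 : ∑ j, A i j • (x j - x i - d i) = 0 := by
          simp only [smul_sub _ _ (d i), Finset.sum_sub_distrib, hd, ← Finset.sum_smul, hA1,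
            one_smul, sub_self]
        simp only [smul_comm _ (2 : ℝ), ← Finset.smul_sum, h0, smul_zero]
      have h := sum_sq_norm_add_le_of_smooth hS (hA i) (hA1 i)
        ((2 : ℝ) • (x i - c) - θ + d i) _ hD
      have e1 (j : ι) : (2 : ℝ) • (x i - c) - θ + d i + (2 : ℝ) • (x j - x i - d i) =
          (2 : ℝ) • (x j - c) - (θ + d i + d j) + d j := by module
      have e2 : ∑ j, A i j * ‖(2 : ℝ) • (x j - x i - d i)‖ ^ 2 = 4 * e i := by
        simp only [he, norm_smul, mul_pow, Finset.mul_sum]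
        refine Finset.sum_congr rfl fun j _ => ?_
        norm_num
        ring
      simp only [e1, e2] at h
      linarith
    have h2 : ∑ j, A i j * ∑ s ∈ Finset.range t, ∑ k, (A ^ s) j k * e k =
        ∑ s ∈ Finset.range t, ∑ k, (A ^ (s + 1)) i k * e k := by
      simp only [pow_succ', Matrix.mul_apply, Finset.sum_mul, Finset.mul_sum]
      rw [Finset.sum_comm]
      refine Finset.sum_congr rfl fun s _ => ?_
      rw [Finset.sum_comm]
      simp only [mul_assoc]
    have h3 : e i = ∑ k, (A ^ 0) i k * e k := by simp [Matrix.one_apply]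
    rw [pathSum]
    refine (Finset.sum_le_sum fun j _ =>
      mul_le_mul_of_nonneg_left (ih j (θ + d i + d j)) (hA i j)).trans ?_
    simp only [mul_add, Finset.sum_add_distrib, mul_left_comm (A i _) (8 * S ^ 2),
      ← Finset.mul_sum]
    rw [h2, Finset.sum_range_succ', ← h3]
    linarith

lemma sum_mul_pow_apply [DecidableEq ι] (hinv : ∀ j, ∑ i, π i * A i j = π j) (t : ℕ) (j : ι) :
    ∑ i, π i * (A ^ t) i j = π j := by
  induction t generalizing j with
  | zero => simp [Matrix.one_apply]
  | succ t ih =>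
    simp only [pow_succ, Matrix.mul_apply, Finset.mul_sum]
    rw [Finset.sum_comm]
    simp only [← mul_assoc, ← Finset.sum_mul, ih, hinv]

lemma pow_apply_nonneg [DecidableEq ι] (hA : ∀ i j, 0 ≤ A i j) (t : ℕ) (i j : ι) :
    0 ≤ (A ^ t) i j := by
  induction t generalizing j with
  | zero => rw [pow_zero, Matrix.one_apply]; split_ifs <;> norm_num
  | succ t ih =>
    rw [pow_succ, Matrix.mul_apply]
    exact Finset.sum_nonneg fun k _ => mul_nonneg (ih k) (hA k j)

lemma sum_pow_apply [DecidableEq ι] (hA1 : ∀ i, ∑ j, A i j = 1) (t : ℕ) (i : ι) :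
    ∑ j, (A ^ t) i j = 1 := by
  induction t generalizing i with
  | zero => simp [Matrix.one_apply]
  | succ t ih =>
    simp only [pow_succ', Matrix.mul_apply]
    rw [Finset.sum_comm]
    simp only [← Finset.mul_sum, ih, mul_one, hA1]

/-- A `2`-smooth space has Markov type `2`: along a stationary reversible chain, the mean square
displacement after `t` steps is at most a constant times `t` times that of one step. The
displacement is half the difference of a forward and a backward martingale, up to the drifts at
the two endpoints. -/
theorem markovType_two_of_smooth [DecidableEq ι] {S : ℝ} (hS1 : 1 ≤ S)
    (hS : ∀ x y : E, ‖x + y‖ ^ 2 + ‖x - y‖ ^ 2 ≤ 2 * ‖x‖ ^ 2 + 2 * S ^ 2 * ‖y‖ ^ 2)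
    (hA : ∀ i j, 0 ≤ A i j) (hA1 : ∀ i, ∑ j, A i j = 1) (hπ : ∀ i, 0 ≤ π i)
    (hrev : ∀ i j, π i * A i j = π j * A j i) (x : ι → E) (t : ℕ) :
    ∑ i, π i * ∑ j, (A ^ t) i j * ‖x i - x j‖ ^ 2 ≤
      18 * S ^ 2 * t * ∑ i, π i * ∑ j, A i j * ‖x i - x j‖ ^ 2 := by
  rcases Nat.eq_zero_or_pos t with rfl | ht
  · simp [Matrix.one_apply]
  set σ := ∑ i, π i * ∑ j, A i j * ‖x i - x j‖ ^ 2 with hσ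
  set d : ι → E := fun i => ∑ j, A i j • (x j - x i) with hd
  have hinv (j : ι) : ∑ i, π i * A i j = π j := by
    simp only [hrev _ j, ← Finset.mul_sum, hA1, mul_one]
  have hstat (s : ℕ) (h : ι → ℝ) : ∑ i, π i * ∑ j, (A ^ s) i j * h j = ∑ j, π j * h j := by
    simp only [Finset.mul_sum]
    rw [Finset.sum_comm]
    simp only [← mul_assoc, ← Finset.sum_mul, sum_mul_pow_apply hinv]
  have hdσ (i : ι) : ‖d i‖ ^ 2 ≤ ∑ j, A i j * ‖x i - x j‖ ^ 2 := by
    simpa only [norm_sub_rev (x i)] using sq_norm_sum_smul_le (hA i) (hA1 i) (fun j => x j - x i)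
  have hdσ' : ∑ i, π i * ‖d i‖ ^ 2 ≤ σ :=
    Finset.sum_le_sum fun i _ => mul_le_mul_of_nonneg_left (hdσ i) (hπ i)
  have hσ0 : 0 ≤ σ := (Finset.sum_nonneg fun i _ =>
    mul_nonneg (hπ i) (sq_nonneg _)).trans hdσ'
  set e : ι → ℝ := fun k => ∑ j, A k j * ‖x j - x k - d k‖ ^ 2 with he
  have heσ : ∑ i, π i * e i ≤ 4 * σ := by
    have h1 (k : ι) : e k ≤ 4 * ∑ j, A k j * ‖x k - x j‖ ^ 2 := by
      have h2 : e k ≤ ∑ j, A k j * (2 * ‖x k - x j‖ ^ 2 + 2 * ‖d k‖ ^ 2) := by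
        refine Finset.sum_le_sum fun j _ => mul_le_mul_of_nonneg_left ?_ (hA k j)
        have h := sq_norm_add_le (x j - x k) (-d k)
        rwa [norm_neg, ← sub_eq_add_neg, norm_sub_rev (x j)] at h
      simp only [mul_add, Finset.sum_add_distrib, ← Finset.sum_mul, hA1, one_mul,
        mul_left_comm (A k _), ← Finset.mul_sum] at h2
      linarith [hdσ k]
    calc ∑ i, π i * e i ≤ ∑ i, π i * (4 * ∑ j, A i j * ‖x i - x j‖ ^ 2) :=
          Finset.sum_le_sum fun i _ => mul_le_mul_of_nonneg_left (h1 i) (hπ i)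
      _ = 4 * σ := by simp only [mul_left_comm (π _), ← Finset.mul_sum, hσ]
  set G : ι → ι → E → ℝ := fun i j θ => ‖(2 : ℝ) • (x j - x i) - θ - d i + d j‖ ^ 2 with hG
  have hGle : ∑ i, π i * pathSum A d t (G i) i 0 ≤ 32 * S ^ 2 * t * σ := by
    have h1 (i : ι) : pathSum A d t (G i) i 0 ≤
        8 * S ^ 2 * ∑ s ∈ Finset.range t, ∑ k, (A ^ s) i k * e k := by
      have h := pathSum_sq_norm_le hS hA hA1 x d (fun _ => rfl) (x i) t i (0 + d i)
      rw [← pathSum_translate] at h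
      have h0 : ‖(2 : ℝ) • (x i - x i) - 0 - d i + d i‖ ^ 2 = 0 := by simp
      simp only [← sub_sub] at h
      rwa [h0, zero_add] at h
    calc ∑ i, π i * pathSum A d t (G i) i 0
        ≤ ∑ i, π i * (8 * S ^ 2 * ∑ s ∈ Finset.range t, ∑ k, (A ^ s) i k * e k) :=
          Finset.sum_le_sum fun i _ => mul_le_mul_of_nonneg_left (h1 i) (hπ i)
      _ = 8 * S ^ 2 * ∑ s ∈ Finset.range t, ∑ i, π i * ∑ k, (A ^ s) i k * e k := by
          simp only [mul_left_comm (π _), ← Finset.mul_sum]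
          rw [Finset.sum_comm]
          simp only [Finset.mul_sum]
      _ = 8 * S ^ 2 * (t * ∑ i, π i * e i) := by
          simp only [hstat, Finset.sum_const, Finset.card_range, nsmul_eq_mul]
      _ ≤ 8 * S ^ 2 * (t * (4 * σ)) := by gcongr
      _ = _ := by ring
  have hGle' : ∑ i, π i * pathSum A d t (fun j θ => G j i θ) i 0 ≤ 32 * S ^ 2 * t * σ := by
    rw [← pathSum_reverse hrev t G]
    exact hGle
  have hpt (i j : ι) (θ : E) : ‖x i - x j‖ ^ 2 ≤
      1 / 4 * G i j θ + (1 / 4 * G j i θ + (‖d i‖ ^ 2 + ‖d j‖ ^ 2)) := by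
    set F := (2 : ℝ) • (x j - x i) - θ - d i + d j
    set B := (2 : ℝ) • (x i - x j) - θ - d j + d i
    have e1 : (4 : ℝ) • (x j - x i) = (F - B) + (2 : ℝ) • (d i - d j) := by
      simp only [F, B]; module
    have h1 := sq_norm_add_le (F - B) ((2 : ℝ) • (d i - d j))
    have h2 := sq_norm_add_le F (-B)
    have h3 := sq_norm_add_le (d i) (-d j)
    rw [← e1, norm_smul, norm_smul, mul_pow, mul_pow] at h1
    rw [norm_neg, ← sub_eq_add_neg] at h2 h3
    rw [norm_sub_rev]
    simp only [hG]
    norm_num at h1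
    linarith
  have hmain (i : ι) : ∑ j, (A ^ t) i j * ‖x i - x j‖ ^ 2 ≤
      1 / 4 * pathSum A d t (G i) i 0 + (1 / 4 * pathSum A d t (fun j θ => G j i θ) i 0 +
        (‖d i‖ ^ 2 + ∑ j, (A ^ t) i j * ‖d j‖ ^ 2)) := by
    have h := pathSum_mono (d := d) hA t (hpt i) i 0
    rw [pathSum_const, pathSum_add, pathSum_add, pathSum_const_mul, pathSum_const_mul,
      pathSum_const] at h
    simpa only [mul_add, Finset.sum_add_distrib, ← Finset.sum_mul, sum_pow_apply hA1, one_mul]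
      using h
  have hsum := Finset.sum_le_sum fun i (_ : i ∈ Finset.univ) =>
    mul_le_mul_of_nonneg_left (hmain i) (hπ i)
  simp only [mul_add, Finset.sum_add_distrib, hstat, mul_left_comm (π _) (1 / 4 : ℝ),
    ← Finset.mul_sum] at hsum
  have hStσ : σ ≤ S ^ 2 * t * σ := by
    have h1 : (1 : ℝ) ≤ t := by exact_mod_cast ht
    have h2 : 1 ≤ S ^ 2 := one_le_pow₀ hS1
    exact le_mul_of_one_le_left hσ0 (one_le_mul_of_one_le_of_one_le h2 h1)
  linarith

end MarkovType

/-! ### The resolvent of a Markov chain -/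

section Resolvent

variable {ι : Type*} [Fintype ι] [DecidableEq ι] {A : Matrix ι ι ℝ} {π : ι → ℝ} {α : ℝ}

/-- The transition probabilities of the chain stopped at an independent geometric time, that is,
the normalized resolvent `(1 - α) (1 - α A)⁻¹`. -/
noncomputable def geometricKernel (A : Matrix ι ι ℝ) (α : ℝ) : Matrix ι ι ℝ :=
  fun i j => ∑' t : ℕ, (1 - α) * α ^ t * (A ^ t) i j

lemma hasSum_geometricKernel (hA : ∀ i j, 0 ≤ A i j) (hA1 : ∀ i, ∑ j, A i j = 1) (hα0 : 0 ≤ α)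
    (hα1 : α < 1) (i j : ι) :
    HasSum (fun t : ℕ => (1 - α) * α ^ t * (A ^ t) i j) (geometricKernel A α i j) := by
  refine Summable.hasSum (Summable.of_nonneg_of_le (fun t => ?_) (fun t => ?_)
    ((summable_geometric_of_lt_one hα0 hα1).mul_left (1 - α)))
  · have := pow_apply_nonneg hA t i j
    have : 0 ≤ 1 - α := by linarith
    positivity
  · have h1 : (A ^ t) i j ≤ 1 := by
      rw [← sum_pow_apply hA1 t i]
      exact Finset.single_le_sum (fun k _ => pow_apply_nonneg hA t i k) (Finset.mem_univ j)
    have : 0 ≤ 1 - α := by linarith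
    exact mul_le_of_le_one_right (by positivity) h1

lemma geometricKernel_nonneg (hA : ∀ i j, 0 ≤ A i j) (hα0 : 0 ≤ α) (hα1 : α < 1) (i j : ι) :
    0 ≤ geometricKernel A α i j := by
  refine tsum_nonneg fun t => ?_
  have := pow_apply_nonneg hA t i j
  have : 0 ≤ 1 - α := by linarith
  positivity

lemma hasSum_geometric_weights (hα0 : 0 ≤ α) (hα1 : α < 1) :
    HasSum (fun t : ℕ => (1 - α) * α ^ t) 1 := by
  have h := (hasSum_geometric_of_lt_one hα0 hα1).mul_left (1 - α)
  rwa [mul_inv_cancel₀ (by linarith)] at h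

lemma sum_geometricKernel (hA : ∀ i j, 0 ≤ A i j) (hA1 : ∀ i, ∑ j, A i j = 1) (hα0 : 0 ≤ α)
    (hα1 : α < 1) (i : ι) : ∑ j, geometricKernel A α i j = 1 := by
  have h := hasSum_sum fun j (_ : j ∈ Finset.univ) => hasSum_geometricKernel hA hA1 hα0 hα1 i j
  simp only [← Finset.mul_sum, sum_pow_apply hA1, mul_one] at h
  exact h.unique (hasSum_geometric_weights hα0 hα1)

lemma sum_mul_geometricKernel (hA : ∀ i j, 0 ≤ A i j) (hA1 : ∀ i, ∑ j, A i j = 1) (hα0 : 0 ≤ α)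
    (hα1 : α < 1) (hinv : ∀ j, ∑ i, π i * A i j = π j) (j : ι) :
    ∑ i, π i * geometricKernel A α i j = π j := by
  have h := hasSum_sum fun i (_ : i ∈ Finset.univ) =>
    (hasSum_geometricKernel hA hA1 hα0 hα1 i j).mul_left (π i)
  simp only [mul_left_comm (π _), ← Finset.mul_sum, sum_mul_pow_apply hinv] at h
  simpa using h.unique ((hasSum_geometric_weights hα0 hα1).mul_right (π j))

/-- The first-step decomposition of the resolvent. -/
lemma geometricKernel_apply_eq (hA : ∀ i j, 0 ≤ A i j) (hA1 : ∀ i, ∑ j, A i j = 1) (hα0 : 0 ≤ α)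
    (hα1 : α < 1) (i j : ι) :
    geometricKernel A α i j = (1 - α) * (1 : Matrix ι ι ℝ) i j +
      α * ∑ k, A i k * geometricKernel A α k j := by
  have h := hasSum_geometricKernel hA hA1 hα0 hα1 i j
  rw [← hasSum_nat_add_iff' 1] at h
  have h' := (hasSum_sum fun k (_ : k ∈ Finset.univ) =>
    (hasSum_geometricKernel hA hA1 hα0 hα1 k j).mul_left (A i k)).mul_left α
  have e : (fun t : ℕ => (1 - α) * α ^ (t + 1) * (A ^ (t + 1)) i j) =
      fun t => α * ∑ k, A i k * ((1 - α) * α ^ t * (A ^ t) k j) := by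
    ext t
    rw [pow_succ' A, Matrix.mul_apply]
    simp only [Finset.mul_sum]
    exact Finset.sum_congr rfl fun k _ => by ring
  rw [e] at h
  have := h.unique h'
  simp at this
  linarith

/-- The last-step decomposition of the resolvent. -/
lemma geometricKernel_apply_eq' (hA : ∀ i j, 0 ≤ A i j) (hA1 : ∀ i, ∑ j, A i j = 1) (hα0 : 0 ≤ α)
    (hα1 : α < 1) (i j : ι) :
    geometricKernel A α i j = (1 - α) * (1 : Matrix ι ι ℝ) i j +
      α * ∑ k, geometricKernel A α i k * A k j := by
  have h := hasSum_geometricKernel hA hA1 hα0 hα1 i j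
  rw [← hasSum_nat_add_iff' 1] at h
  have h' := (hasSum_sum fun k (_ : k ∈ Finset.univ) =>
    (hasSum_geometricKernel hA hA1 hα0 hα1 i k).mul_right (A k j)).mul_left α
  have e : (fun t : ℕ => (1 - α) * α ^ (t + 1) * (A ^ (t + 1)) i j) =
      fun t => α * ∑ k, ((1 - α) * α ^ t * (A ^ t) i k) * A k j := by
    ext t
    rw [pow_succ A, Matrix.mul_apply]
    simp only [Finset.mul_sum]
    exact Finset.sum_congr rfl fun k _ => by ring
  rw [e] at h
  have := h.unique h'
  simp at this
  linarith

/-- Markov type `2` for the geometric time, whose mean is `α / (1 - α)`. -/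
lemma markovType_two_geometricKernel {E : Type*} [NormedAddCommGroup E] [NormedSpace ℝ E] {S : ℝ}
    (hS1 : 1 ≤ S)
    (hS : ∀ x y : E, ‖x + y‖ ^ 2 + ‖x - y‖ ^ 2 ≤ 2 * ‖x‖ ^ 2 + 2 * S ^ 2 * ‖y‖ ^ 2)
    (hA : ∀ i j, 0 ≤ A i j) (hA1 : ∀ i, ∑ j, A i j = 1) (hπ : ∀ i, 0 ≤ π i)
    (hrev : ∀ i j, π i * A i j = π j * A j i) (hα0 : 0 ≤ α) (hα1 : α < 1) (x : ι → E) :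
    ∑ i, π i * ∑ j, geometricKernel A α i j * ‖x i - x j‖ ^ 2 ≤
      18 * S ^ 2 * (α / (1 - α)) * ∑ i, π i * ∑ j, A i j * ‖x i - x j‖ ^ 2 := by
  set σ := ∑ i, π i * ∑ j, A i j * ‖x i - x j‖ ^ 2
  have h1α : 0 < 1 - α := by linarith
  have h1 := hasSum_sum fun i (_ : i ∈ Finset.univ) =>
    (hasSum_sum fun j (_ : j ∈ Finset.univ) =>
      (hasSum_geometricKernel hA hA1 hα0 hα1 i j).mul_right (‖x i - x j‖ ^ 2)).mul_left (π i)
  have h2 := ((hasSum_coe_mul_geometric_of_norm_lt_one (r := α)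
    (by rwa [Real.norm_of_nonneg hα0])).mul_left (18 * S ^ 2 * (1 - α))).mul_right σ
  refine (hasSum_le (fun t => ?_) h1 h2).trans_eq (by field_simp)
  have h := mul_le_mul_of_nonneg_left (markovType_two_of_smooth hS1 hS hA hA1 hπ hrev x t)
    (by positivity : 0 ≤ (1 - α) * α ^ t)
  calc _ = (1 - α) * α ^ t * ∑ i, π i * ∑ j, (A ^ t) i j * ‖x i - x j‖ ^ 2 := by
        simp only [Finset.mul_sum]
        exact Finset.sum_congr rfl fun i _ => Finset.sum_congr rfl fun j _ => by ring
    _ ≤ _ := h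
    _ = _ := by ring

end Resolvent

/-! ### Harmonic extensions and their energy -/

section Energy

variable {X Y : Type*} [NormedAddCommGroup X] [NormedSpace ℝ X]
  [NormedAddCommGroup Y] [NormedSpace ℝ Y] {ι κ : Type*} [Fintype ι] [Fintype κ]

/-- Let `y` be the harmonic extension of the boundary values `f`: from `i` the chain is stopped at
a geometric time and then sent to the boundary by `β`. In a `2`-convex space the values of `y`
along the chain form a martingale whose quadratic variation, on the left, is controlled by the
final mean square distance to an arbitrary point `v`. -/
lemma exists_harmonic_extension [DecidableEq ι] {c : ℝ}
    (hc : ∀ x y : Y, 2 * ‖x‖ ^ 2 + 2 * c * ‖y‖ ^ 2 ≤ ‖x + y‖ ^ 2 + ‖x - y‖ ^ 2)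
    {A : Matrix ι ι ℝ} {β : ι → κ → ℝ} {α : ℝ} (hA : ∀ i j, 0 ≤ A i j)
    (hA1 : ∀ i, ∑ j, A i j = 1) (hβ : ∀ i k, 0 ≤ β i k) (hβ1 : ∀ i, ∑ k, β i k = 1)
    (hα0 : 0 ≤ α) (hα1 : α < 1) (f : κ → Y) :
    ∃ y : ι → Y, ∀ (i : ι) (v : Y),
      (1 - α) * ‖y i - v‖ ^ 2 + c / 2 * ∑ j, geometricKernel A α i j *
        ((1 - α) * ∑ k, β j k * ‖f k - y j‖ ^ 2 + α * ∑ l, A j l * ‖y l - y j‖ ^ 2) ≤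
      (1 - α) * ∑ j, geometricKernel A α i j * ∑ k, β j k * ‖f k - v‖ ^ 2 := by
  set C := geometricKernel A α with hC
  set u : ι → Y := fun j => ∑ k, β j k • f k with hu
  set y : ι → Y := fun i => ∑ j, C i j • u j with hy
  have h1α : 0 < 1 - α := by linarith
  have hyu (i : ι) : (1 - α) • u i + α • ∑ j, A i j • y j = y i := by
    have h1 : y i = ∑ j, ((1 - α) * (1 : Matrix ι ι ℝ) i j + α * ∑ k, A i k * C k j) • u j :=
      Finset.sum_congr rfl fun j _ => by rw [hC, geometricKernel_apply_eq hA hA1 hα0 hα1]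
    rw [h1]
    simp only [add_smul, Finset.sum_add_distrib, mul_smul, ← Finset.smul_sum, hy,
      Finset.sum_smul]
    congr 2
    · simp [Matrix.one_apply]
    · simp only [Finset.smul_sum]
      rw [Finset.sum_comm]
  refine ⟨y, fun i v => ?_⟩
  have hC0 (j : ι) : 0 ≤ C i j := geometricKernel_nonneg hA hα0 hα1 i j
  set w : ι → ℝ := fun j =>
    (1 - α) * ∑ k, β j k * ‖f k - y j‖ ^ 2 + α * ∑ l, A j l * ‖y l - y j‖ ^ 2 with hw
  have hstep (j : ι) : ‖y j - v‖ ^ 2 + c / 2 * w j ≤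
      (1 - α) * ∑ k, β j k * ‖f k - v‖ ^ 2 + α * ∑ l, A j l * ‖y l - v‖ ^ 2 := by
    have h := sq_norm_add_variance_le_of_convex hc
      (p := Sum.elim (fun k => (1 - α) * β j k) (fun l => α * A j l))
      (by
        rintro (k | l)
        · exact mul_nonneg h1α.le (hβ j k)
        · exact mul_nonneg hα0 (hA j l))
      (by simp [← Finset.mul_sum, hβ1, hA1])
      (Sum.elim (fun k => f k - v) (fun l => y l - v)) (y j - v)
      (by
        simp only [Fintype.sum_sum_type, Sum.elim_inl, Sum.elim_inr, mul_smul,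
          ← Finset.smul_sum, smul_sub _ _ v, Finset.sum_sub_distrib, ← Finset.sum_smul,
          hβ1, hA1, one_smul]
        rw [← hyu j]
        simp only [hu]
        module)
    simpa [Fintype.sum_sum_type, mul_assoc, ← Finset.mul_sum, hw] using h
  have hsum := Finset.sum_le_sum fun j (_ : j ∈ Finset.univ) =>
    mul_le_mul_of_nonneg_left (hstep j) (hC0 j)
  -- The recursion for the kernel turns `∑ j, C i j * ‖y j - v‖ ^ 2` into its boundary term.
  have hrec : ∑ j, C i j * ‖y j - v‖ ^ 2 =
      (1 - α) * ‖y i - v‖ ^ 2 + α * ∑ j, C i j * ∑ l, A j l * ‖y l - v‖ ^ 2 := by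
    have h1 : ∑ j, C i j * ‖y j - v‖ ^ 2 = ∑ j, ((1 - α) * (1 : Matrix ι ι ℝ) i j +
        α * ∑ k, C i k * A k j) * ‖y j - v‖ ^ 2 :=
      Finset.sum_congr rfl fun j _ => by rw [hC, ← geometricKernel_apply_eq' hA hA1 hα0 hα1]
    rw [h1]
    simp only [add_mul, Finset.sum_add_distrib, mul_assoc, ← Finset.mul_sum, Finset.sum_mul]
    congr 2
    · simp [Matrix.one_apply]
    · rw [Finset.sum_comm]
      simp only [Finset.mul_sum]
  simp only [mul_add (C i _), Finset.sum_add_distrib,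
    mul_left_comm (C i _) (c / 2), mul_left_comm (C i _) (1 - α), mul_left_comm (C i _) α,
    ← Finset.mul_sum] at hsum
  rw [hrec] at hsum
  simp only [hw] at hsum
  linarith

/-- The energy estimate, for edge weights `a` on the interior whose row sums are proportional to
the total boundary weights: the harmonic extension has energy at most a constant times that of
any configuration `x` inside a `2`-smooth space. -/
lemma exists_energy_le_of_sum_eq {S c : ℝ} (hS1 : 1 ≤ S)
    (hS : ∀ x y : X, ‖x + y‖ ^ 2 + ‖x - y‖ ^ 2 ≤ 2 * ‖x‖ ^ 2 + 2 * S ^ 2 * ‖y‖ ^ 2)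
    (hc1 : c ≤ 1)
    (hc : ∀ x y : Y, 2 * ‖x‖ ^ 2 + 2 * c * ‖y‖ ^ 2 ≤ ‖x + y‖ ^ 2 + ‖x - y‖ ^ 2)
    {a : ι → ι → ℝ} {b : ι → κ → ℝ} (ha : ∀ i j, 0 ≤ a i j) (hab : ∀ i j, a i j = a j i)
    (hb : ∀ i k, 0 ≤ b i k) (hb0 : ∀ i, 0 < ∑ k, b i k) {T : ℝ} (hT : 0 < T)
    (haT : ∀ i, ∑ j, a i j = T * ∑ k, b i k) (x : ι → X) (z : κ → X) (f : κ → Y) {L : ℝ}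
    (hf : ∀ k l, ‖f k - f l‖ ≤ L * ‖z k - z l‖) :
    ∃ y : ι → Y, c * (∑ i, ∑ j, a i j * ‖y i - y j‖ ^ 2 +
        2 * ∑ i, ∑ k, b i k * ‖y i - f k‖ ^ 2) ≤
      108 * S ^ 2 * L ^ 2 * (∑ i, ∑ j, a i j * ‖x i - x j‖ ^ 2 +
        2 * ∑ i, ∑ k, b i k * ‖x i - z k‖ ^ 2) := by
  classical
  set r : ι → ℝ := fun i => ∑ k, b i k with hr
  set A : Matrix ι ι ℝ := fun i j => a i j / (T * r i) with hAdef
  set β : ι → κ → ℝ := fun i k => b i k / r i with hβdef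
  -- The interior chain has rates `a / r`, so that it is reversible for `r`, and is killed at
  -- rate one.
  set α : ℝ := T / (1 + T) with hα
  have hr0 (i : ι) : 0 < r i := hb0 i
  have hα0 : 0 ≤ α := by positivity
  have h1α : 1 - α = 1 / (1 + T) := by rw [hα]; field_simp; ring
  have h1α0 : 0 < 1 - α := by rw [h1α]; positivity
  have hα1 : α < 1 := by linarith
  have hA (i j : ι) : 0 ≤ A i j := div_nonneg (ha i j) (mul_pos hT (hr0 i)).le
  have hA1 (i : ι) : ∑ j, A i j = 1 := by
    simp only [hAdef, ← Finset.sum_div, haT]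
    exact div_self (mul_pos hT (hr0 i)).ne'
  have hβ (i : ι) (k : κ) : 0 ≤ β i k := div_nonneg (hb i k) (hr0 i).le
  have hβ1 (i : ι) : ∑ k, β i k = 1 := by
    simp only [hβdef, ← Finset.sum_div]
    exact div_self (hr0 i).ne'
  have hrA (i j : ι) : r i * A i j = a i j / T := by
    have := (hr0 i).ne'
    simp only [hAdef]
    field_simp
  have hrβ (i : ι) (k : κ) : r i * β i k = b i k := mul_div_cancel₀ _ (hr0 i).ne'
  have hrev (i j : ι) : r i * A i j = r j * A j i := by rw [hrA, hrA, hab]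
  have hinv (j : ι) : ∑ i, r i * A i j = r j := by
    simp only [hrev _ j, ← Finset.mul_sum, hA1, mul_one]
  obtain ⟨y, hy⟩ := exists_harmonic_extension hc hA hA1 hβ hβ1 hα0 hα1 f
  refine ⟨y, ?_⟩
  set C := geometricKernel A α with hC
  have hC0 (i j : ι) : 0 ≤ C i j := geometricKernel_nonneg hA hα0 hα1 i j
  have hC1 (i : ι) : ∑ j, C i j = 1 := sum_geometricKernel hA hA1 hα0 hα1 i
  have hCinv (j : ι) : ∑ i, r i * C i j = r j := sum_mul_geometricKernel hA hA1 hα0 hα1 hinv j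
  have hCstat (h : ι → ℝ) : ∑ i, r i * ∑ j, C i j * h j = ∑ j, r j * h j := by
    simp only [Finset.mul_sum]
    rw [Finset.sum_comm]
    simp only [← mul_assoc, ← Finset.sum_mul, hCinv]
  have hrβsum (i : ι) (h : κ → ℝ) : r i * ∑ k, β i k * h k = ∑ k, b i k * h k := by
    simp only [Finset.mul_sum, ← mul_assoc, hrβ]
  have hrAsum (h : ι → ι → ℝ) :
      T * ∑ i, r i * ∑ j, A i j * h i j = ∑ i, ∑ j, a i j * h i j := by
    simp only [Finset.mul_sum]
    refine Finset.sum_congr rfl fun i _ => Finset.sum_congr rfl fun j _ => ?_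
    rw [← mul_assoc (r i), hrA]
    field_simp
  set EA := ∑ i, ∑ j, a i j * ‖y i - y j‖ ^ 2 with hEA
  set EB := ∑ i, ∑ k, b i k * ‖y i - f k‖ ^ 2 with hEB
  set XA := ∑ i, ∑ j, a i j * ‖x i - x j‖ ^ 2 with hXA
  set XB := ∑ i, ∑ k, b i k * ‖x i - z k‖ ^ 2 with hXB
  have hEB0 : 0 ≤ EB := Finset.sum_nonneg fun i _ => Finset.sum_nonneg fun k _ =>
    mul_nonneg (hb i k) (sq_nonneg _)
  have hXB0 : 0 ≤ XB := Finset.sum_nonneg fun i _ => Finset.sum_nonneg fun k _ =>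
    mul_nonneg (hb i k) (sq_nonneg _)
  set Q := ∑ i, ∑ l, b i l * ∑ j, C i j * ∑ k, β j k * ‖f k - f l‖ ^ 2 with hQ
  have hYside : EB + c / 2 * (EB + EA) ≤ Q := by
    set w : ι → ℝ := fun j =>
      (1 - α) * ∑ k, β j k * ‖f k - y j‖ ^ 2 + α * ∑ l, A j l * ‖y l - y j‖ ^ 2 with hw
    have h1 : ∑ i, ∑ l, b i l * ((1 - α) * ‖y i - f l‖ ^ 2 + c / 2 * ∑ j, C i j * w j) ≤
        ∑ i, ∑ l, b i l * ((1 - α) * ∑ j, C i j * ∑ k, β j k * ‖f k - f l‖ ^ 2) :=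
      Finset.sum_le_sum fun i _ => Finset.sum_le_sum fun l _ =>
        mul_le_mul_of_nonneg_left (hy i (f l)) (hb i l)
    have h2 : ∑ i, ∑ l, b i l * (c / 2 * ∑ j, C i j * w j) = c / 2 * ∑ j, r j * w j := by
      simp only [mul_left_comm (b _ _), ← Finset.mul_sum, ← Finset.sum_mul]
      rw [← hCstat w]
    have h3 : ∑ j, r j * w j = (1 - α) * (EB + EA) := by
      have e1 : α = (1 - α) * T := by rw [h1α, hα]; ring
      simp only [hw, mul_add, Finset.sum_add_distrib, mul_left_comm (r _), ← Finset.mul_sum,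
        hrβsum]
      rw [e1, ← e1, hEB, hEA, ← hrAsum, ← mul_assoc (1 - α), ← e1]
      simp only [norm_sub_rev]
    simp only [mul_add (b _ _), Finset.sum_add_distrib, mul_left_comm (b _ _) (1 - α),
      ← Finset.mul_sum] at h1
    rw [h2, h3] at h1
    have h4 : (1 - α) * (EB + c / 2 * (EB + EA)) ≤ (1 - α) * Q := by
      simp only [hEB, hQ] at h1 ⊢
      linarith
    exact le_of_mul_le_mul_left h4 h1α0
  have hXside : Q ≤ 3 * L ^ 2 * (2 * XB + 18 * S ^ 2 * XA) := by
    have h1 (i j : ι) (k l : κ) : ‖f k - f l‖ ^ 2 ≤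
        3 * L ^ 2 * (‖x i - z l‖ ^ 2 + (‖x i - x j‖ ^ 2 + ‖x j - z k‖ ^ 2)) := by
      have h2 : ‖f k - f l‖ ^ 2 ≤ L ^ 2 * ‖z k - z l‖ ^ 2 := by
        rw [← mul_pow]
        exact pow_le_pow_left₀ (norm_nonneg _) (hf k l) 2
      have h3 : ‖z k - z l‖ ≤ ‖x i - z l‖ + (‖x i - x j‖ + ‖x j - z k‖) := by
        have e : z k - z l = (x i - z l) - ((x i - x j) + (x j - z k)) := by abel
        rw [e]
        exact (norm_sub_le _ _).trans (by gcongr; exact norm_add_le _ _)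
      have h4 : ‖z k - z l‖ ^ 2 ≤
          3 * (‖x i - z l‖ ^ 2 + (‖x i - x j‖ ^ 2 + ‖x j - z k‖ ^ 2)) := by
        refine (pow_le_pow_left₀ (norm_nonneg _) h3 2).trans ?_
        nlinarith [sq_nonneg (‖x i - z l‖ - ‖x i - x j‖), sq_nonneg (‖x i - z l‖ - ‖x j - z k‖),
          sq_nonneg (‖x i - x j‖ - ‖x j - z k‖)]
      calc _ ≤ _ := h2
        _ ≤ L ^ 2 * (3 * (‖x i - z l‖ ^ 2 + (‖x i - x j‖ ^ 2 + ‖x j - z k‖ ^ 2))) := by gcongr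
        _ = _ := by ring
    have h5 : Q ≤ ∑ i, ∑ l, b i l * ∑ j, C i j * ∑ k, β j k *
        (3 * L ^ 2 * (‖x i - z l‖ ^ 2 + (‖x i - x j‖ ^ 2 + ‖x j - z k‖ ^ 2))) := by
      refine Finset.sum_le_sum fun i _ => Finset.sum_le_sum fun l _ =>
        mul_le_mul_of_nonneg_left (Finset.sum_le_sum fun j _ =>
          mul_le_mul_of_nonneg_left (Finset.sum_le_sum fun k _ =>
            mul_le_mul_of_nonneg_left (h1 i j k l) (hβ j k)) (hC0 i j)) (hb i l)
    have hmt := markovType_two_geometricKernel hS1 hS hA hA1 (fun i => (hr0 i).le) hrev hα0 hα1 x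
    have e1 : α / (1 - α) = T := by rw [h1α, hα]; field_simp
    rw [e1, mul_assoc (18 * S ^ 2), hrAsum (fun i j => ‖x i - x j‖ ^ 2), ← hC, ← hXA] at hmt
    have e2 (i : ι) (D : ℝ) : ∑ l, b i l * D = r i * D := by rw [hr, Finset.sum_mul]
    simp only [mul_left_comm (β _ _) (3 * L ^ 2), mul_add (β _ _), mul_add (C _ _),
      mul_left_comm (C _ _) (3 * L ^ 2), mul_left_comm (b _ _) (3 * L ^ 2), mul_add (b _ _),
      Finset.sum_add_distrib, ← Finset.mul_sum, ← Finset.sum_mul, hβ1, hC1, one_mul,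
      e2, hCstat, hrβsum] at h5
    have h6 : 3 * L ^ 2 * (XB + (∑ i, r i * ∑ j, C i j * ‖x i - x j‖ ^ 2 + XB)) ≤
        3 * L ^ 2 * (XB + (18 * S ^ 2 * XA + XB)) := by gcongr
    simp only [hXB] at h6 ⊢
    linarith
  have hS2 : XB ≤ S ^ 2 * XB := le_mul_of_one_le_left hXB0 (one_le_pow₀ hS1)
  have h7 : c * EB ≤ EB := mul_le_of_le_one_left hEB0 hc1
  have h8 : L ^ 2 * XB ≤ L ^ 2 * (S ^ 2 * XB) := by gcongr
  have h9 : 0 ≤ L ^ 2 * (S ^ 2 * XB) := by positivity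
  linarith

/-- The energy estimate for arbitrary edge weights: symmetrizing `a` doubles the energy of the
interior pairs, and adding a diagonal matrix, which makes the row sums proportional to those of
`b`, does not affect it. -/
lemma exists_energy_le {S c : ℝ} (hS1 : 1 ≤ S)
    (hS : ∀ x y : X, ‖x + y‖ ^ 2 + ‖x - y‖ ^ 2 ≤ 2 * ‖x‖ ^ 2 + 2 * S ^ 2 * ‖y‖ ^ 2)
    (hc1 : c ≤ 1)
    (hc : ∀ x y : Y, 2 * ‖x‖ ^ 2 + 2 * c * ‖y‖ ^ 2 ≤ ‖x + y‖ ^ 2 + ‖x - y‖ ^ 2)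
    {a : ι → ι → ℝ} {b : ι → κ → ℝ} (ha : ∀ i j, 0 ≤ a i j)
    (hb : ∀ i k, 0 ≤ b i k) (hb0 : ∀ i, 0 < ∑ k, b i k)
    (x : ι → X) (z : κ → X) (f : κ → Y) {L : ℝ}
    (hf : ∀ k l, ‖f k - f l‖ ≤ L * ‖z k - z l‖) :
    ∃ y : ι → Y, c * (∑ i, ∑ j, a i j * ‖y i - y j‖ ^ 2 +
        ∑ i, ∑ k, b i k * ‖y i - f k‖ ^ 2) ≤
      108 * S ^ 2 * L ^ 2 * (∑ i, ∑ j, a i j * ‖x i - x j‖ ^ 2 +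
        ∑ i, ∑ k, b i k * ‖x i - z k‖ ^ 2) := by
  classical
  set r : ι → ℝ := fun i => ∑ k, b i k with hr
  set s : ι → ℝ := fun i => ∑ j, (a i j + a j i) with hs
  have hs0 (i : ι) : 0 ≤ s i := Finset.sum_nonneg fun j _ => add_nonneg (ha i j) (ha j i)
  set T : ℝ := 1 + ∑ i, s i / r i with hT
  have hT0 : 0 < T := by
    have : 0 ≤ ∑ i, s i / r i := Finset.sum_nonneg fun i _ => div_nonneg (hs0 i) (hb0 i).le
    linarith
  have hsT (i : ι) : s i ≤ T * r i := by
    have h1 : s i / r i ≤ T := by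
      have := Finset.single_le_sum (f := fun i => s i / r i)
        (fun i _ => div_nonneg (hs0 i) (hb0 i).le) (Finset.mem_univ i)
      linarith
    rwa [div_le_iff₀ (hb0 i)] at h1
  set a' : ι → ι → ℝ := fun i j => a i j + a j i + if i = j then T * r i - s i else 0 with ha'
  have hsum (D : ι → ι → ℝ) (hD : ∀ i j, D i j = D j i) (hD0 : ∀ i, D i i = 0) :
      ∑ i, ∑ j, a' i j * D i j = 2 * ∑ i, ∑ j, a i j * D i j := by
    have h1 : ∑ i, ∑ j, a j i * D i j = ∑ i, ∑ j, a i j * D i j := by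
      rw [Finset.sum_comm]
      exact Finset.sum_congr rfl fun i _ => Finset.sum_congr rfl fun j _ => by rw [hD]
    simp only [ha', add_mul, Finset.sum_add_distrib, h1, ite_mul, zero_mul, Finset.sum_ite_eq,
      Finset.mem_univ, if_true, hD0, mul_zero, add_zero, two_mul]
  obtain ⟨y, hy⟩ := exists_energy_le_of_sum_eq (a := a') hS1 hS hc1 hc
    (fun i j => by
      have := ha i j
      have := ha j i
      have := hsT i
      simp only [ha']
      split_ifs <;> linarith)
    (fun i j => by
      simp only [ha']
      rcases eq_or_ne i j with rfl | h
      · rfl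
      · rw [if_neg h, if_neg h.symm, add_comm (a i j)])
    hb hb0 hT0 (fun i => by
      simp only [ha', Finset.sum_add_distrib, Finset.sum_ite_eq, Finset.mem_univ, if_true,
        hs, hr]
      ring) x z f hf
  refine ⟨y, ?_⟩
  rw [hsum (fun i j => ‖y i - y j‖ ^ 2) (fun i j => by rw [norm_sub_rev]) (by simp),
    hsum (fun i j => ‖x i - x j‖ ^ 2) (fun i j => by rw [norm_sub_rev]) (by simp),
    ← mul_add, ← mul_add] at hy
  linarith

end Energy

/-! ### From averaged estimates to Lipschitz estimates on finite sets -/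

/-- A minimax principle: if every positive combination of the nonnegative convex functions `φ e`
can be made smaller, by a definite factor, than the same combination of the `p e`, then all of
them can be made smaller simultaneously. -/
lemma exists_forall_lt_of_forall_sum_le {W ε : Type*} [AddCommGroup W] [Module ℝ W] [Fintype ε]
    {φ : ε → W → ℝ} (hφ : ∀ e, ConvexOn ℝ Set.univ (φ e)) (hφ0 : ∀ e y, 0 ≤ φ e y)
    {p : ε → ℝ} (hp : ∀ e, 0 < p e) {θ : ℝ} (hθ : θ < 1)
    (h : ∀ w : ε → ℝ, (∀ e, 0 < w e) → ∃ y, ∑ e, w e * φ e y ≤ θ * ∑ e, w e * p e) :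
    ∃ y, ∀ e, φ e y < p e := by
  classical
  by_contra hcon
  set U : Set (ε → ℝ) := {t | ∃ y, ∀ e, φ e y < t e} with hU
  have hUconv : Convex ℝ U := by
    rintro t ⟨y, hy⟩ t' ⟨y', hy'⟩ a b ha hb hab
    refine ⟨a • y + b • y', fun e => ?_⟩
    refine ((hφ e).2 (Set.mem_univ y) (Set.mem_univ y') ha hb hab).trans_lt ?_
    simp only [smul_eq_mul, Pi.add_apply, Pi.smul_apply]
    rcases ha.eq_or_lt with rfl | ha'
    · have hb1 : b = 1 := by linarith
      simpa [hb1] using hy' e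
    · have h1 := mul_lt_mul_of_pos_left (hy e) ha'
      have h2 := mul_le_mul_of_nonneg_left (hy' e).le hb
      linarith
  have hUopen : IsOpen U := by
    have e1 : U = ⋃ y, Set.pi Set.univ fun e => Set.Ioi (φ e y) := by
      ext t
      simp [hU]
    rw [e1]
    exact isOpen_iUnion fun y => isOpen_set_pi Set.finite_univ fun e _ => isOpen_Ioi
  obtain ⟨g, hg⟩ := geometric_hahn_banach_open_point hUconv hUopen (x := p) hcon
  set w : ε → ℝ := fun e => -g (Pi.single e 1) with hw
  have hgw (t : ε → ℝ) : g t = -∑ e, w e * t e := by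
    have h1 := congrArg g (pi_eq_sum_univ' t)
    rw [h1, map_sum, ← Finset.sum_neg_distrib]
    refine Finset.sum_congr rfl fun e _ => ?_
    rw [map_smul, smul_eq_mul, hw]
    simp only [neg_mul, neg_neg]
    rw [mul_comm]
  have hlt (t : ε → ℝ) (ht : t ∈ U) : ∑ e, w e * p e < ∑ e, w e * t e := by
    have := hg t ht
    rw [hgw, hgw] at this
    linarith
  have hUφ (y : W) (δ : ℝ) (hδ : 0 < δ) : (fun e => φ e y + δ) ∈ U := ⟨y, fun e => by linarith⟩
  have hw0 (e : ε) : 0 ≤ w e := by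
    by_contra hneg
    push Not at hneg
    set t0 : ε → ℝ := fun e => φ e 0 + 1
    set s : ℝ := |∑ e, w e * t0 e - ∑ e, w e * p e| / (-w e) with hs
    have hs0 : 0 ≤ s := div_nonneg (abs_nonneg _) (by linarith)
    have h1 := hlt (fun j => t0 j + if j = e then s else 0) ⟨0, fun j => by
      simp only [t0]
      split_ifs <;> linarith⟩
    simp only [mul_add, Finset.sum_add_distrib, mul_ite, mul_zero, Finset.sum_ite_eq',
      Finset.mem_univ, if_true] at h1
    have h2 : w e * s = -|∑ e, w e * t0 e - ∑ e, w e * p e| := by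
      rw [hs]
      have := hneg.ne
      field_simp
    have h3 := le_abs_self (∑ e, w e * t0 e - ∑ e, w e * p e)
    linarith
  set P := ∑ e, w e * p e with hP
  have hP0 : 0 < P := by
    have h0 : 0 ≤ P := Finset.sum_nonneg fun e _ => mul_nonneg (hw0 e) (hp e).le
    refine h0.lt_of_ne fun h1 => ?_
    have h2 : ∀ e, w e = 0 := fun e => by
      have := (Finset.sum_eq_zero_iff_of_nonneg
        fun e _ => mul_nonneg (hw0 e) (hp e).le).1 h1.symm e (Finset.mem_univ e)
      exact (mul_eq_zero.1 this).resolve_right (hp e).ne'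
    have h3 := hlt _ (hUφ 0 1 one_pos)
    simp [hP, h2] at h3
  have hsw : 0 ≤ ∑ e, w e := Finset.sum_nonneg fun e _ => hw0 e
  have hsp : 0 ≤ ∑ e, p e := Finset.sum_nonneg fun e _ => (hp e).le
  set η := (1 - θ) * P / 2 with hη
  have hη0 : 0 < η := by
    have : 0 < 1 - θ := by linarith
    positivity
  -- The weights `w` may vanish somewhere, so they are perturbed to positive ones.
  obtain ⟨y, hy⟩ := h (fun e => w e + η / (∑ e, p e + 1)) fun e => by
    have := hw0 e
    positivity
  have h1 := hlt _ (hUφ y (η / (∑ e, w e + 1)) (by positivity))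
  have h2 : ∑ e, w e * φ e y ≤ ∑ e, (w e + η / (∑ e, p e + 1)) * φ e y :=
    Finset.sum_le_sum fun e _ => mul_le_mul_of_nonneg_right
      (le_add_of_nonneg_right (by positivity)) (hφ0 e y)
  have h3 : η / (∑ e, p e + 1) * ∑ e, p e ≤ η := by
    rw [div_mul_eq_mul_div, div_le_iff₀ (by positivity)]
    nlinarith
  have h4 : (∑ e, w e) * (η / (∑ e, w e + 1)) ≤ η := by
    rw [mul_div_assoc', div_le_iff₀ (by positivity)]
    nlinarith
  simp only [add_mul, mul_add, Finset.sum_add_distrib, ← Finset.mul_sum, ← Finset.sum_mul]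
    at hy h1 h2
  have h5 : θ * (η / (∑ e, p e + 1) * ∑ e, p e) ≤ 1 * η := by
    gcongr
  linarith

section FiniteExtension

variable {X Y : Type*} [NormedAddCommGroup X] [NormedSpace ℝ X]
  [NormedAddCommGroup Y] [NormedSpace ℝ Y]

lemma convexOn_sq_norm_comp {W : Type*} [AddCommGroup W] [Module ℝ W] (g : W →ₗ[ℝ] Y) (v : Y) :
    ConvexOn ℝ Set.univ fun y => ‖g y - v‖ ^ 2 := by
  have h1 : ConvexOn ℝ Set.univ fun u : Y => ‖u + -v‖ :=
    (convexOn_univ_norm (E := Y)).translate_left (-v)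
  have h2 := (h1.comp_linearMap g).pow (fun _ _ => norm_nonneg _) 2
  simp only [sub_eq_add_neg]
  exact h2

/-- The extension of a Lipschitz map to finitely many further points. -/
lemma exists_extension_finite {ι κ : Type*} [Fintype ι] [Fintype κ] [Nonempty κ] {S c : ℝ}
    (hS1 : 1 ≤ S)
    (hS : ∀ x y : X, ‖x + y‖ ^ 2 + ‖x - y‖ ^ 2 ≤ 2 * ‖x‖ ^ 2 + 2 * S ^ 2 * ‖y‖ ^ 2)
    (hc0 : 0 < c) (hc1 : c ≤ 1)
    (hc : ∀ x y : Y, 2 * ‖x‖ ^ 2 + 2 * c * ‖y‖ ^ 2 ≤ ‖x + y‖ ^ 2 + ‖x - y‖ ^ 2)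
    {Γ : ℝ} (hΓ0 : 0 < Γ) (hΓ : 108 * S ^ 2 / c < Γ ^ 2)
    (x : ι → X) (hx : Function.Injective x) (z : κ → X) (hxz : ∀ i k, x i ≠ z k)
    (f : κ → Y) {L : ℝ} (hL : 0 < L) (hf : ∀ k l, ‖f k - f l‖ ≤ L * ‖z k - z l‖) :
    ∃ y : ι → Y, (∀ i j, ‖y i - y j‖ ≤ Γ * L * ‖x i - x j‖) ∧
      ∀ i k, ‖y i - f k‖ ≤ Γ * L * ‖x i - z k‖ := by
  classical
  set φ : (ι × ι) ⊕ (ι × κ) → (ι → Y) → ℝ :=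
    Sum.elim (fun e y => ‖y e.1 - y e.2‖ ^ 2) (fun e y => ‖y e.1 - f e.2‖ ^ 2) with hφdef
  -- The degenerate pairs `(i, i)` get an arbitrary positive bound.
  set p : (ι × ι) ⊕ (ι × κ) → ℝ :=
    Sum.elim (fun e => if e.1 = e.2 then 1 else Γ ^ 2 * L ^ 2 * ‖x e.1 - x e.2‖ ^ 2)
      (fun e => Γ ^ 2 * L ^ 2 * ‖x e.1 - z e.2‖ ^ 2) with hpdef
  have hφ : ∀ e, ConvexOn ℝ Set.univ (φ e) := by
    rintro (⟨i, j⟩ | ⟨i, k⟩)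
    · have h := convexOn_sq_norm_comp
        (LinearMap.proj (R := ℝ) (φ := fun _ : ι => Y) i - LinearMap.proj j) (0 : Y)
      simp only [sub_zero] at h
      exact h
    · exact convexOn_sq_norm_comp (LinearMap.proj (R := ℝ) (φ := fun _ : ι => Y) i) (f k)
  have hφ0 : ∀ e y, 0 ≤ φ e y := by
    rintro (⟨i, j⟩ | ⟨i, k⟩) y <;> exact sq_nonneg _
  have hp : ∀ e, 0 < p e := by
    rintro (⟨i, j⟩ | ⟨i, k⟩)
    · simp only [p, Sum.elim_inl]
      split_ifs with h
      · exact one_pos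
      · have : 0 < ‖x i - x j‖ := norm_pos_iff.2 (sub_ne_zero.2 fun h' => h (hx h'))
        positivity
    · have : 0 < ‖x i - z k‖ := norm_pos_iff.2 (sub_ne_zero.2 (hxz i k))
      simp only [p, Sum.elim_inr]
      positivity
  have hcΓ : 0 < c * Γ ^ 2 := by positivity
  obtain ⟨y, hy⟩ := exists_forall_lt_of_forall_sum_le hφ hφ0 hp
    (θ := 108 * S ^ 2 / (c * Γ ^ 2))
    (by
      rw [div_lt_iff₀ hc0] at hΓ
      rw [div_lt_one hcΓ]
      linarith)
    (by
      intro w hw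
      obtain ⟨y, hy⟩ := exists_energy_le hS1 hS hc1 hc
        (a := fun i j => w (Sum.inl (i, j))) (b := fun i k => w (Sum.inr (i, k)))
        (fun i j => (hw _).le) (fun i k => (hw _).le)
        (fun i => Finset.sum_pos (fun k _ => hw _) Finset.univ_nonempty) x z f hf
      refine ⟨y, ?_⟩
      have h1 : Γ ^ 2 * L ^ 2 * (∑ i, ∑ j, w (Sum.inl (i, j)) * ‖x i - x j‖ ^ 2 +
          ∑ i, ∑ k, w (Sum.inr (i, k)) * ‖x i - z k‖ ^ 2) ≤ ∑ e, w e * p e := by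
        simp only [Fintype.sum_sum_type, Fintype.sum_prod_type, mul_add, Finset.mul_sum, p,
          Sum.elim_inl, Sum.elim_inr]
        refine add_le_add (Finset.sum_le_sum fun i _ => Finset.sum_le_sum fun j _ => ?_)
          (Finset.sum_le_sum fun i _ => Finset.sum_le_sum fun k _ => ?_)
        · rw [mul_left_comm]
          refine mul_le_mul_of_nonneg_left ?_ (hw _).le
          split_ifs with h
          · simp [h]
          · rfl
        · rw [mul_left_comm]
      simp only [Fintype.sum_sum_type (f := fun e => w e * φ e y), Fintype.sum_prod_type, φ,
        Sum.elim_inl, Sum.elim_inr]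
      rw [div_mul_eq_mul_div, le_div_iff₀ hcΓ]
      have h2 := mul_le_mul_of_nonneg_left h1 (by positivity : 0 ≤ 108 * S ^ 2)
      have h3 := mul_le_mul_of_nonneg_left hy (by positivity : 0 ≤ Γ ^ 2)
      linarith)
  have hsq {s D : ℝ} (hD : 0 ≤ D) (h : s ^ 2 < Γ ^ 2 * L ^ 2 * D ^ 2) : s ≤ Γ * L * D := by
    rw [← mul_pow, ← mul_pow] at h
    exact (abs_le_of_sq_le_sq' h.le (by positivity)).2
  refine ⟨y, fun i j => ?_, fun i k => hsq (norm_nonneg _) (hy (Sum.inr (i, k)))⟩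
  rcases eq_or_ne i j with rfl | h
  · simp
  · have h1 := hy (Sum.inl (i, j))
    simp only [φ, p, Sum.elim_inl, if_neg h] at h1
    exact hsq (norm_nonneg _) h1

end FiniteExtension

/-! ### Weak limits in `2`-convex spaces -/

section WeakLimit

open Filter Topology

variable {Y : Type*} [NormedAddCommGroup Y] [NormedSpace ℝ Y]

/-- In a complete `2`-convex space, bounded families have weak limits along ultrafilters. The
closed convex hulls of the tails have points of almost minimal norm, and by convexity these form a
Cauchy sequence; its limit lies in all the hulls. -/
lemma exists_weak_limit [CompleteSpace Y] {c : ℝ} (hc0 : 0 < c)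
    (hc : ∀ x y : Y, 2 * ‖x‖ ^ 2 + 2 * c * ‖y‖ ^ 2 ≤ ‖x + y‖ ^ 2 + ‖x - y‖ ^ 2)
    {I : Type*} (U : Ultrafilter I) (y : I → Y) {R : ℝ} (hR : ∀ᶠ i in (U : Filter I), ‖y i‖ ≤ R) :
    ∃ m : Y, ∀ φ : StrongDual ℝ Y, Tendsto (fun i => φ (y i)) U (𝓝 (φ m)) := by
  set H : Set I → Set Y := fun s => closure (convexHull ℝ (y '' s)) with hH
  have hHmono {s t : Set I} (h : s ⊆ t) : H s ⊆ H t :=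
    closure_mono (convexHull_mono (Set.image_mono h))
  have hHconv (s : Set I) : Convex ℝ (H s) := (convex_convexHull ℝ _).closure
  have hyH {s : Set I} {i : I} (hi : i ∈ s) : y i ∈ H s :=
    subset_closure (subset_convexHull ℝ _ (Set.mem_image_of_mem y hi))
  set N : Set I → ℝ := fun s => sInf ((fun v => ‖v‖ ^ 2) '' H s) with hN
  have hbdd (s : Set I) : BddBelow ((fun v : Y => ‖v‖ ^ 2) '' H s) :=
    ⟨0, by rintro _ ⟨v, _, rfl⟩; exact sq_nonneg _⟩
  have hNle {s : Set I} {v : Y} (hv : v ∈ H s) : N s ≤ ‖v‖ ^ 2 :=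
    csInf_le (hbdd s) (Set.mem_image_of_mem _ hv)
  have hNR {s : Set I} (hs : s ∈ U) : N s ≤ R ^ 2 := by
    obtain ⟨i, hi, hiR⟩ := U.nonempty_of_mem (inter_mem hs hR)
    exact (hNle (hyH hi)).trans (pow_le_pow_left₀ (norm_nonneg _) hiR 2)
  set D : ℝ := sSup (N '' {s | s ∈ U}) with hD
  have hbddD : BddAbove (N '' {s | s ∈ U}) := ⟨R ^ 2, by rintro _ ⟨s, hs, rfl⟩; exact hNR hs⟩
  have hND {s : Set I} (hs : s ∈ U) : N s ≤ D := le_csSup hbddD (Set.mem_image_of_mem _ hs)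
  have happrox {s : Set I} (hs : s ∈ U) {ε : ℝ} (hε : 0 < ε) : ∃ v ∈ H s, ‖v‖ ^ 2 < D + ε := by
    obtain ⟨i, hi⟩ := U.nonempty_of_mem hs
    obtain ⟨_, ⟨v, hv, rfl⟩, hlt⟩ := exists_lt_of_csInf_lt
      (Set.Nonempty.image (fun v : Y => ‖v‖ ^ 2) ⟨y i, hyH hi⟩)
      (show N s < D + ε by have := hND hs; linarith)
    exact ⟨v, hv, hlt⟩
  have hclose {s : Set I} {δ : ℝ} (hδ : 0 ≤ δ) (hsD : D - c / 8 * δ ^ 2 < N s) {v v' : Y}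
      (hv : v ∈ H s) (hv' : v' ∈ H s) (h : ‖v‖ ^ 2 < D + c / 8 * δ ^ 2)
      (h' : ‖v'‖ ^ 2 < D + c / 8 * δ ^ 2) : ‖v - v'‖ ≤ δ := by
    have h1 := hc ((2⁻¹ : ℝ) • (v + v')) ((2⁻¹ : ℝ) • (v - v'))
    have e1 : (2⁻¹ : ℝ) • (v + v') + (2⁻¹ : ℝ) • (v - v') = v := by module
    have e2 : (2⁻¹ : ℝ) • (v + v') - (2⁻¹ : ℝ) • (v - v') = v' := by module
    have h2 : (2⁻¹ : ℝ) • (v + v') ∈ H s := by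
      rw [smul_add]
      exact hHconv s hv hv' (by norm_num) (by norm_num) (by norm_num)
    have h3 := hNle h2
    rw [e1, e2, norm_smul (2⁻¹ : ℝ) (v - v'), mul_pow,
      show ‖(2⁻¹ : ℝ)‖ ^ 2 = 1 / 4 by norm_num] at h1
    have h4 : c * ‖v - v'‖ ^ 2 ≤ c * δ ^ 2 := by linarith
    exact (abs_le_of_sq_le_sq' (le_of_mul_le_mul_left h4 hc0) hδ).2
  set δ : ℕ → ℝ := fun n => (1 / 2) ^ n with hδ
  have hδ0 (n : ℕ) : 0 < δ n := by positivity
  have hε (n : ℕ) : 0 < c / 8 * δ n ^ 2 := by have := hδ0 n; positivity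
  have hδlim : Tendsto δ atTop (𝓝 0) :=
    tendsto_pow_atTop_nhds_zero_of_lt_one (by norm_num) (by norm_num)
  have hs (n : ℕ) : ∃ s ∈ U, D - c / 8 * δ n ^ 2 < N s := by
    obtain ⟨_, ⟨s, hs, rfl⟩, hlt⟩ := exists_lt_of_lt_csSup
      (Set.Nonempty.image N ⟨Set.univ, (univ_mem : Set.univ ∈ (U : Filter I))⟩)
      (show D - c / 8 * δ n ^ 2 < sSup (N '' {s | s ∈ U}) by have := hε n; linarith)
    exact ⟨s, hs, hlt⟩
  choose s hsU hsD using hs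
  have hv (n : ℕ) := happrox (hsU n) (hε n)
  choose v hvH hvD using hv
  have hcauchy : CauchySeq v := by
    refine cauchySeq_of_le_tendsto_0 (fun n => 2 * δ n) (fun n m k hn hm => ?_)
      (by simpa using hδlim.const_mul 2)
    -- Both points are compared with a third one in the smaller hull.
    obtain ⟨u, huH, huD⟩ := happrox (inter_mem (hsU n) (hsU m)) (lt_min (hε n) (hε m))
    have h1 := hclose (hδ0 n).le (hsD n) (hvH n) (hHmono Set.inter_subset_left huH) (hvD n)
      (huD.trans_le (by gcongr; exact min_le_left _ _))
    have h2 := hclose (hδ0 m).le (hsD m) (hvH m) (hHmono Set.inter_subset_right huH) (hvD m)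
      (huD.trans_le (by gcongr; exact min_le_right _ _))
    have hanti {a b : ℕ} (hab : a ≤ b) : δ b ≤ δ a :=
      pow_le_pow_of_le_one (by norm_num) (by norm_num) hab
    rw [dist_eq_norm]
    calc ‖v n - v m‖ = ‖(v n - u) - (v m - u)‖ := by congr 1; abel
      _ ≤ ‖v n - u‖ + ‖v m - u‖ := norm_sub_le _ _
      _ ≤ 2 * δ k := by have := hanti hn; have := hanti hm; linarith
  obtain ⟨m, hm⟩ := cauchySeq_tendsto_of_complete hcauchy
  have hmH {B : Set I} (hB : B ∈ U) : m ∈ H B := by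
    have hu (n : ℕ) := happrox (inter_mem (hsU n) hB) (hε n)
    choose u huH huD using hu
    have h1 (n : ℕ) : ‖u n - v n‖ ≤ δ n :=
      hclose (hδ0 n).le (hsD n) (hHmono Set.inter_subset_left (huH n)) (hvH n) (huD n) (hvD n)
    have h2 : Tendsto (fun n => v n + (u n - v n)) atTop (𝓝 (m + 0)) :=
      hm.add (squeeze_zero_norm h1 hδlim)
    simp only [add_sub_cancel, add_zero] at h2
    exact isClosed_closure.mem_of_tendsto h2
      (Eventually.of_forall fun n => hHmono Set.inter_subset_right (huH n))
  have hhalf (φ : StrongDual ℝ Y) {a : ℝ} (ha : a < φ m) : ∀ᶠ i in (U : Filter I), a < φ (y i) := by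
    by_contra hcon
    rw [← Ultrafilter.eventually_not] at hcon
    have h1 : H {i | ¬ a < φ (y i)} ⊆ {v | φ v ≤ a} := by
      refine closure_minimal (convexHull_min ?_ ?_) (isClosed_le φ.continuous continuous_const)
      · rintro _ ⟨i, hi, rfl⟩
        exact not_lt.1 hi
      · exact convex_halfSpace_le φ.isLinear a
    exact absurd (h1 (hmH hcon)) (not_le.2 ha)
  refine ⟨m, fun φ => tendsto_order.2 ⟨fun a ha => hhalf φ ha, fun a ha => ?_⟩⟩
  filter_upwards [hhalf (-φ) (a := -a) (by simpa using ha)] with i hi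
  simpa using hi

/-- The norm is weakly lower semicontinuous. -/
lemma norm_sub_le_of_tendsto_weak {I : Type*} {l : Filter I} [l.NeBot] {y y' : I → Y} {m m' : Y}
    (h : ∀ φ : StrongDual ℝ Y, Tendsto (fun i => φ (y i)) l (𝓝 (φ m)))
    (h' : ∀ φ : StrongDual ℝ Y, Tendsto (fun i => φ (y' i)) l (𝓝 (φ m')))
    {B : ℝ} (hB : ∀ᶠ i in l, ‖y i - y' i‖ ≤ B) : ‖m - m'‖ ≤ B := by
  obtain ⟨φ, hφ, hφm⟩ := exists_dual_vector'' ℝ (m - m')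
  have h1 : ‖m - m'‖ = φ m - φ m' := by
    rw [← map_sub, hφm]
    rfl
  rw [h1]
  refine le_of_tendsto ((h φ).sub (h' φ)) ?_
  filter_upwards [hB] with i hi
  rw [← map_sub]
  exact (le_abs_self _).trans ((φ.le_of_opNorm_le hφ _).trans (by simpa using hi))

end WeakLimit

/-! ### The extension theorem -/

section Extension

open Filter Topology

variable {X Y : Type*} [NormedAddCommGroup X] [NormedSpace ℝ X]
  [NormedAddCommGroup Y] [NormedSpace ℝ Y]

/-- Extension of a Lipschitz map so that the Lipschitz estimate holds on a prescribed finite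
set. -/
lemma exists_extension_on_finset {S c : ℝ} (hS1 : 1 ≤ S)
    (hS : ∀ x y : X, ‖x + y‖ ^ 2 + ‖x - y‖ ^ 2 ≤ 2 * ‖x‖ ^ 2 + 2 * S ^ 2 * ‖y‖ ^ 2)
    (hc0 : 0 < c) (hc1 : c ≤ 1)
    (hc : ∀ x y : Y, 2 * ‖x‖ ^ 2 + 2 * c * ‖y‖ ^ 2 ≤ ‖x + y‖ ^ 2 + ‖x - y‖ ^ 2)
    {Γ : ℝ} (hΓ1 : 1 ≤ Γ) (hΓ : 108 * S ^ 2 / c < Γ ^ 2) {Z : Set X} (hZ : Z.Nonempty)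
    (f : Z → Y) {L : ℝ} (hL : 0 < L) (hf : ∀ z z' : Z, ‖f z - f z'‖ ≤ L * ‖(z : X) - z'‖)
    (F : Finset X) :
    ∃ g : X → Y, (∀ z : Z, g z = f z) ∧
      ∀ x ∈ F, ∀ x' ∈ F, ‖g x - g x'‖ ≤ Γ * L * ‖x - x'‖ := by
  classical
  obtain ⟨z₀, hz₀⟩ := hZ
  set F' := insert z₀ F with hF'
  have : Nonempty {x : F' // x.1 ∈ Z} := ⟨⟨⟨z₀, Finset.mem_insert_self _ _⟩, hz₀⟩⟩
  obtain ⟨y, hy1, hy2⟩ := exists_extension_finite hS1 hS hc0 hc1 hc (by linarith) hΓ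
    (fun i : {x : F' // x.1 ∉ Z} => i.1.1) (fun i j h => Subtype.ext (Subtype.ext h))
    (fun k : {x : F' // x.1 ∈ Z} => k.1.1) (fun i k h => i.2 (h ▸ k.2))
    (fun k => f ⟨k.1.1, k.2⟩) hL (fun k l => hf _ _)
  set g : X → Y := fun x => if h : x ∈ Z then f ⟨x, h⟩ else
    if h' : x ∈ F' then y ⟨⟨x, h'⟩, h⟩ else 0 with hg
  have hgZ {x : X} (h : x ∈ Z) : g x = f ⟨x, h⟩ := by simp only [hg, dif_pos h]
  have hgF {x : X} (h' : x ∈ F') (h : x ∉ Z) : g x = y ⟨⟨x, h'⟩, h⟩ := by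
    simp only [hg, dif_neg h, dif_pos h']
  refine ⟨g, fun z => hgZ z.2, fun x hx x' hx' => ?_⟩
  have hxF : x ∈ F' := Finset.mem_insert_of_mem hx
  have hxF' : x' ∈ F' := Finset.mem_insert_of_mem hx'
  by_cases h : x ∈ Z <;> by_cases h' : x' ∈ Z
  · rw [hgZ h, hgZ h']
    refine (hf _ _).trans ?_
    rw [mul_assoc]
    exact le_mul_of_one_le_left (by positivity) hΓ1
  · rw [hgZ h, hgF hxF' h', norm_sub_rev, norm_sub_rev x]
    exact hy2 ⟨⟨x', hxF'⟩, h'⟩ ⟨⟨x, hxF⟩, h⟩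
  · rw [hgF hxF h, hgZ h']
    exact hy2 ⟨⟨x, hxF⟩, h⟩ ⟨⟨x', hxF'⟩, h'⟩
  · rw [hgF hxF h, hgF hxF' h']
    exact hy1 _ _

/-- The extension theorem: extensions that are Lipschitz on larger and larger finite sets converge
weakly, along an ultrafilter, to a Lipschitz extension. -/
theorem lipschitzExtends_of_smooth_of_convex [CompleteSpace Y] {S c : ℝ} (hS1 : 1 ≤ S)
    (hS : ∀ x y : X, ‖x + y‖ ^ 2 + ‖x - y‖ ^ 2 ≤ 2 * ‖x‖ ^ 2 + 2 * S ^ 2 * ‖y‖ ^ 2)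
    (hc0 : 0 < c) (hc1 : c ≤ 1)
    (hc : ∀ x y : Y, 2 * ‖x‖ ^ 2 + 2 * c * ‖y‖ ^ 2 ≤ ‖x + y‖ ^ 2 + ‖x - y‖ ^ 2)
    {Γ : ℝ≥0} (hΓ : 108 * S ^ 2 / c < (Γ : ℝ) ^ 2) : LipschitzExtends X Y Γ := by
  classical
  intro Z f L hf
  rcases Z.eq_empty_or_nonempty with hZ | hZ
  · exact ⟨fun _ => 0, (LipschitzWith.const 0).weaken zero_le,
      fun z => (hZ ▸ z.2 : (z : X) ∈ (∅ : Set X)).elim⟩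
  obtain ⟨z₀, hz₀⟩ := hZ
  rcases eq_or_ne L 0 with rfl | hL
  · refine ⟨fun _ => f ⟨z₀, hz₀⟩, (LipschitzWith.const _).weaken zero_le, fun z => ?_⟩
    have := hf.dist_le_mul ⟨z₀, hz₀⟩ z
    simpa using this
  have hL0 : (0 : ℝ) < L := by exact_mod_cast pos_iff_ne_zero.2 hL
  have hΓ1 : (1 : ℝ) ≤ Γ := by
    have h1 : 1 ≤ 108 * S ^ 2 / c := by
      rw [le_div_iff₀ hc0]
      nlinarith
    have h2 : (1 : ℝ) ^ 2 ≤ (Γ : ℝ) ^ 2 := by linarith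
    exact (abs_le_of_sq_le_sq' h2 Γ.2).2
  have hf' (z z' : Z) : ‖f z - f z'‖ ≤ L * ‖(z : X) - z'‖ := by
    simpa [dist_eq_norm, Subtype.dist_eq] using hf.dist_le_mul z z'
  choose g hgf hgL using
    exists_extension_on_finset hS1 hS hc0 hc1 hc hΓ1 hΓ ⟨z₀, hz₀⟩ f hL0 hf'
  let U : Ultrafilter (Finset X) := Ultrafilter.of atTop
  have hU (x x' : X) : ∀ᶠ F in (U : Filter (Finset X)),
      ‖g F x - g F x'‖ ≤ Γ * L * ‖x - x'‖ := by
    have h1 : ∀ᶠ F : Finset X in atTop, {x, x'} ≤ F := eventually_ge_atTop _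
    filter_upwards [Ultrafilter.of_le atTop h1] with F hF
    exact hgL F x (hF (by simp)) x' (hF (by simp))
  have hbdd (x : X) : ∀ᶠ F in (U : Filter (Finset X)),
      ‖g F x‖ ≤ ‖f ⟨z₀, hz₀⟩‖ + Γ * L * ‖x - z₀‖ := by
    filter_upwards [hU x z₀] with F hF
    have h1 := hgf F ⟨z₀, hz₀⟩
    rw [h1] at hF
    have h2 := norm_sub_norm_le (g F x) (f ⟨z₀, hz₀⟩)
    linarith
  choose G hG using fun x => exists_weak_limit hc0 hc U (fun F => g F x) (hbdd x)
  refine ⟨G, LipschitzWith.of_dist_le_mul fun x x' => ?_, fun z => ?_⟩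
  · rw [dist_eq_norm, dist_eq_norm]
    push_cast
    exact norm_sub_le_of_tendsto_weak (hG x) (hG x') (hU x x')
  · have h1 := norm_sub_le_of_tendsto_weak (B := 0) (hG z)
      (y' := fun _ => f z) (m' := f z) (fun φ => tendsto_const_nhds)
      (Eventually.of_forall fun F => by rw [hgf F z, sub_self, norm_zero])
    exact sub_eq_zero.1 (norm_le_zero_iff.1 h1)

end Extension

/-! ### The constants of smoothness and convexity -/

section Constants

lemma LipschitzExtends.of_subsingleton_left {X Y : Type*} [MetricSpace X] [MetricSpace Y]
    [Subsingleton X] [Nonempty Y] (K : ℝ≥0) : LipschitzExtends X Y K := by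
  intro Z f L _
  rcases Z.eq_empty_or_nonempty with rfl | ⟨z₀, hz₀⟩
  · exact ⟨fun _ => Classical.arbitrary Y, (LipschitzWith.const _).weaken zero_le,
      fun z => z.2.elim⟩
  · exact ⟨fun _ => f ⟨z₀, hz₀⟩, (LipschitzWith.const _).weaken zero_le,
      fun z => congrArg f (Subsingleton.elim _ _)⟩

lemma LipschitzExtends.of_subsingleton_right {X Y : Type*} [MetricSpace X] [MetricSpace Y]
    [Subsingleton Y] [Nonempty Y] (K : ℝ≥0) : LipschitzExtends X Y K := fun _ _ _ _ =>
  ⟨fun _ => Classical.arbitrary Y, (LipschitzWith.const _).weaken zero_le,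
    fun _ => Subsingleton.elim _ _⟩

lemma LipschitzExtends.extensionConstant_le {X Y : Type*} [MetricSpace X] [MetricSpace Y]
    {K : ℝ≥0} (h : LipschitzExtends X Y K) : extensionConstant X Y ≤ K := iInf₂_le K h

variable {X : Type*} [NormedAddCommGroup X] [NormedSpace ℝ X]

lemma smooth_of_smoothnessConstant_lt {T : ℝ≥0} (h : smoothnessConstant 2 X < T) (x y : X) :
    ‖x + y‖ ^ 2 + ‖x - y‖ ^ 2 ≤ 2 * ‖x‖ ^ 2 + 2 * (T : ℝ) ^ 2 * ‖y‖ ^ 2 := by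
  simp only [smoothnessConstant, iInf_lt_iff] at h
  obtain ⟨S, ⟨_, hS⟩, hST⟩ := h
  have h1 : (S : ℝ) ≤ T := by exact_mod_cast hST.le
  have h2 := hS x y
  simp only [Real.rpow_two] at h2
  refine h2.trans ?_
  gcongr

lemma convex_of_convexityConstant_lt {T : ℝ≥0} (h : convexityConstant 2 X < T) (x y : X) :
    2 * ‖x‖ ^ 2 + 2 * (1 / (T : ℝ) ^ 2) * ‖y‖ ^ 2 ≤ ‖x + y‖ ^ 2 + ‖x - y‖ ^ 2 := by
  simp only [convexityConstant, iInf_lt_iff] at h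
  obtain ⟨K, ⟨hK0, hK⟩, hKT⟩ := h
  have h0 : (0 : ℝ) < K := by exact_mod_cast hK0
  have h1 : (K : ℝ) ≤ T := by exact_mod_cast hKT.le
  have h2 := hK x y
  simp only [Real.rpow_two] at h2
  refine le_trans ?_ h2
  rw [mul_one_div]
  gcongr

lemma one_le_of_smooth {X : Type*} [NormedAddCommGroup X] [Nontrivial X] {T : ℝ} (hT : 0 ≤ T)
    (h : ∀ x y : X, ‖x + y‖ ^ 2 + ‖x - y‖ ^ 2 ≤ 2 * ‖x‖ ^ 2 + 2 * T ^ 2 * ‖y‖ ^ 2) : 1 ≤ T := by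
  obtain ⟨y, hy⟩ := exists_ne (0 : X)
  have hy0 : 0 < ‖y‖ ^ 2 := by have := norm_pos_iff.2 hy; positivity
  have h1 := h 0 y
  simp only [zero_add, zero_sub, norm_neg, norm_zero] at h1
  have h2 : 1 * ‖y‖ ^ 2 ≤ T ^ 2 * ‖y‖ ^ 2 := by linarith
  have h3 : (1 : ℝ) ^ 2 ≤ T ^ 2 := by
    have := le_of_mul_le_mul_right h2 hy0
    linarith
  exact (abs_le_of_sq_le_sq' h3 hT).2

lemma le_one_of_convex {X : Type*} [NormedAddCommGroup X] [Nontrivial X] {c : ℝ}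
    (h : ∀ x y : X, 2 * ‖x‖ ^ 2 + 2 * c * ‖y‖ ^ 2 ≤ ‖x + y‖ ^ 2 + ‖x - y‖ ^ 2) : c ≤ 1 := by
  obtain ⟨y, hy⟩ := exists_ne (0 : X)
  have hy0 : 0 < ‖y‖ ^ 2 := by have := norm_pos_iff.2 hy; positivity
  have h1 := h 0 y
  simp only [zero_add, zero_sub, norm_neg, norm_zero] at h1
  have h2 : c * ‖y‖ ^ 2 ≤ 1 * ‖y‖ ^ 2 := by linarith
  exact le_of_mul_le_mul_right h2 hy0

lemma smoothnessConstant_ne_zero [Nontrivial X] : smoothnessConstant 2 X ≠ 0 := fun h => by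
  have h1 := one_le_of_smooth (T := (2⁻¹ : ℝ≥0)) (by positivity)
    (smooth_of_smoothnessConstant_lt (X := X) (T := 2⁻¹) (by rw [h]; simp))
  norm_num at h1

lemma convexityConstant_ne_zero [Nontrivial X] : convexityConstant 2 X ≠ 0 := fun h => by
  have h1 := le_one_of_convex (c := 1 / ((2⁻¹ : ℝ≥0) : ℝ) ^ 2)
    (convex_of_convexityConstant_lt (X := X) (T := 2⁻¹) (by rw [h]; simp))
  norm_num at h1

/-- If one of the spaces is trivial, its constant is `0` and a constant map extends; otherwise both
constants are positive. -/
theorem lipschitzExtends_of_constants_eq {Y : Type*} [NormedAddCommGroup Y] [NormedSpace ℝ Y]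
    [CompleteSpace Y] {S K : ℝ≥0} (hS : smoothnessConstant 2 X = S)
    (hK : convexityConstant 2 Y = K) : LipschitzExtends X Y (24 * S * K) := by
  rcases subsingleton_or_nontrivial X with hX | hX
  · exact .of_subsingleton_left _
  rcases subsingleton_or_nontrivial Y with hY | hY
  · exact .of_subsingleton_right _
  have hS0 : 0 < S := pos_iff_ne_zero.2 fun h =>
    smoothnessConstant_ne_zero (X := X) (by simp [hS, h])
  have hK0 : 0 < K := pos_iff_ne_zero.2 fun h =>
    convexityConstant_ne_zero (X := Y) (by simp [hK, h])
  -- The infima need not be known to be attained: `108 * (5 / 4) ^ 4 < 24 ^ 2` leaves room.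
  have hS' := smooth_of_smoothnessConstant_lt (X := X) (T := 5 / 4 * S) (by
    rw [hS]
    exact_mod_cast lt_mul_of_one_lt_left hS0 (by norm_num [← NNReal.coe_lt_coe]))
  have hK' := convex_of_convexityConstant_lt (X := Y) (T := 5 / 4 * K) (by
    rw [hK]
    exact_mod_cast lt_mul_of_one_lt_left hK0 (by norm_num [← NNReal.coe_lt_coe]))
  have hS0' : (0 : ℝ) < S := hS0
  have hK0' : (0 : ℝ) < K := hK0
  push_cast at hS' hK'
  refine lipschitzExtends_of_smooth_of_convex (one_le_of_smooth (by positivity) hS') hS'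
    (by positivity) (le_one_of_convex hK') hK' ?_
  push_cast
  have : 0 < (S : ℝ) ^ 2 * (K : ℝ) ^ 2 := by positivity
  rw [div_div_eq_mul_div, div_one]
  nlinarith

theorem extensionConstant_le_mul {Y : Type*} [NormedAddCommGroup Y] [NormedSpace ℝ Y]
    [CompleteSpace Y] :
    extensionConstant X Y ≤ 24 * smoothnessConstant 2 X * convexityConstant 2 Y := by
  rcases subsingleton_or_nontrivial X with hX | hX
  · exact ((LipschitzExtends.of_subsingleton_left 0).extensionConstant_le).trans (by simp)
  rcases subsingleton_or_nontrivial Y with hY | hY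
  · exact ((LipschitzExtends.of_subsingleton_right 0).extensionConstant_le).trans (by simp)
  have hS0 := smoothnessConstant_ne_zero (X := X)
  have hK0 := convexityConstant_ne_zero (X := Y)
  rcases eq_or_ne (smoothnessConstant 2 X) ⊤ with hS | hS
  · simp [hS, ENNReal.mul_top, ENNReal.top_mul, hK0]
  rcases eq_or_ne (convexityConstant 2 Y) ⊤ with hK | hK
  · rw [hK, ENNReal.mul_top (mul_ne_zero (by norm_num) hS0)]
    exact le_top
  have h := (lipschitzExtends_of_constants_eq (ENNReal.coe_toNNReal hS).symm
    (ENNReal.coe_toNNReal hK).symm).extensionConstant_le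
  rwa [ENNReal.coe_mul, ENNReal.coe_mul, ENNReal.coe_toNNReal hS, ENNReal.coe_toNNReal hK] at h

lemma smoothnessConstant_le {S : ℝ} (hS0 : 0 < S)
    (hS : ∀ x y : X, ‖x + y‖ ^ 2 + ‖x - y‖ ^ 2 ≤ 2 * ‖x‖ ^ 2 + 2 * S ^ 2 * ‖y‖ ^ 2) :
    smoothnessConstant 2 X ≤ ENNReal.ofReal S := by
  refine iInf₂_le S.toNNReal ⟨Real.toNNReal_pos.2 hS0, fun x y => ?_⟩
  simp only [Real.rpow_two, Real.coe_toNNReal _ hS0.le]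
  exact hS x y

lemma convexityConstant_le {K : ℝ} (hK0 : 0 < K)
    (hK : ∀ x y : X, 2 * ‖x‖ ^ 2 + 2 / K ^ 2 * ‖y‖ ^ 2 ≤ ‖x + y‖ ^ 2 + ‖x - y‖ ^ 2) :
    convexityConstant 2 X ≤ ENNReal.ofReal K := by
  refine iInf₂_le K.toNNReal ⟨Real.toNNReal_pos.2 hK0, fun x y => ?_⟩
  simp only [Real.rpow_two, Real.coe_toNNReal _ hK0.le]
  exact hK x y

end Constants

/-! ### Moduli of power type `2` -/

section Moduli

variable {X : Type*} [NormedAddCommGroup X] [NormedSpace ℝ X]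

lemma HasSmoothnessPowerType.smoothnessConstant_ne_top (h : HasSmoothnessPowerType 2 X) :
    smoothnessConstant 2 X ≠ ⊤ := by
  obtain ⟨K₀, hK₀⟩ := h
  set K := max K₀ 0 with hKdef
  have hK0 : 0 ≤ K := le_max_right _ _
  have hunit (u v : X) (hu : ‖u‖ = 1) (hv : ‖v‖ = 1) (τ : ℝ) (hτ : 0 < τ) :
      ‖u + τ • v‖ + ‖u - τ • v‖ ≤ 2 + 2 * K * τ ^ 2 := by
    have h1 : (((‖u + τ • v‖ + ‖u - τ • v‖) / 2 - 1 : ℝ) : EReal) ≤ smoothnessModulus X τ :=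
      le_iSup₂_of_le u v (le_iSup_of_le ⟨hu, hv⟩ le_rfl)
    have h2 := EReal.coe_le_coe_iff.1 (h1.trans (hK₀ τ hτ))
    rw [Real.rpow_two] at h2
    have h3 : K₀ * τ ^ 2 ≤ K * τ ^ 2 := by gcongr; exact le_max_left _ _
    linarith
  set S : ℝ := K + 2 with hS
  refine ((smoothnessConstant_le (X := X) (S := S) (by positivity) fun x y => ?_).trans_lt
    ENNReal.ofReal_lt_top).ne
  have hadd : ‖x + y‖ ≤ ‖x‖ + ‖y‖ := norm_add_le _ _
  have hsub : ‖x - y‖ ≤ ‖x‖ + ‖y‖ := norm_sub_le _ _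
  have hdiff : |‖x + y‖ - ‖x - y‖| ≤ 2 * ‖y‖ := by
    have h1 := abs_norm_sub_norm_le (x + y) (x - y)
    have h2 : x + y - (x - y) = (2 : ℝ) • y := by module
    rw [h2, norm_smul] at h1
    simpa using h1
  have hx0 := norm_nonneg x
  have hy0 := norm_nonneg y
  rcases le_or_gt ‖x‖ ‖y‖ with hxy | hxy
  · have h1 := pow_le_pow_left₀ (norm_nonneg _) hadd 2
    have h2 := pow_le_pow_left₀ (norm_nonneg _) hsub 2
    have h3 : 4 * ‖y‖ ^ 2 ≤ S ^ 2 * ‖y‖ ^ 2 := by gcongr; nlinarith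
    nlinarith
  rcases eq_or_ne y 0 with rfl | hy
  · simp
    linarith
  have hx : 0 < ‖x‖ := by linarith
  have hy' : 0 < ‖y‖ := norm_pos_iff.2 hy
  -- After scaling `‖x‖` to one, the modulus is applied with `τ = ‖y‖ / ‖x‖ ≤ 1`.
  have h1 := hunit (‖x‖⁻¹ • x) (‖y‖⁻¹ • y) (norm_smul_inv_norm (𝕜 := ℝ) (norm_pos_iff.1 hx))
    (norm_smul_inv_norm (𝕜 := ℝ) hy) (‖y‖ / ‖x‖) (by positivity)
  have e1 : (‖y‖ / ‖x‖) • ‖y‖⁻¹ • y = ‖x‖⁻¹ • y := by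
    rw [smul_smul]
    congr 1
    field_simp
  rw [e1, ← smul_add, ← smul_sub, norm_smul, norm_smul, norm_inv, norm_norm, ← mul_add,
    inv_mul_le_iff₀ hx] at h1
  have h2 : ‖x + y‖ + ‖x - y‖ ≤ 2 * ‖x‖ + 2 * (K * (‖y‖ / ‖x‖)) * ‖y‖ := by
    refine h1.trans_eq ?_
    field_simp
  set τ := ‖y‖ / ‖x‖ with hτ
  have hτ1 : τ ≤ 1 := (div_le_one hx).2 hxy.le
  have hτ0 : 0 ≤ τ := by positivity
  have e2 : τ * ‖x‖ = ‖y‖ := div_mul_cancel₀ _ hx.ne'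
  have h3 : (‖x + y‖ + ‖x - y‖) ^ 2 ≤ (2 * ‖x‖ + 2 * (K * τ) * ‖y‖) ^ 2 :=
    pow_le_pow_left₀ (by positivity) h2 2
  have h4 : (‖x + y‖ - ‖x - y‖) ^ 2 ≤ (2 * ‖y‖) ^ 2 :=
    sq_le_sq' (abs_le.1 hdiff).1 (abs_le.1 hdiff).2
  have h5 : (2 * ‖x‖ + 2 * (K * τ) * ‖y‖) ^ 2 ≤
      4 * ‖x‖ ^ 2 + 8 * K * ‖y‖ ^ 2 + 4 * K ^ 2 * ‖y‖ ^ 2 := by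
    have e3 : (2 * ‖x‖ + 2 * (K * τ) * ‖y‖) ^ 2 =
        4 * ‖x‖ ^ 2 + 8 * K * (τ * ‖x‖) * ‖y‖ + 4 * (K ^ 2 * τ ^ 2) * ‖y‖ ^ 2 := by ring
    have h6 : K ^ 2 * τ ^ 2 ≤ K ^ 2 * 1 := by gcongr; exact pow_le_one₀ hτ0 hτ1
    have h7 : (K ^ 2 * τ ^ 2) * ‖y‖ ^ 2 ≤ K ^ 2 * 1 * ‖y‖ ^ 2 := by gcongr
    rw [e3, e2]
    linarith
  have h8 : 0 ≤ K * ‖y‖ ^ 2 := by positivity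
  rw [hS]
  nlinarith

/-- Let `u` be a unit vector and `w` a vector of the unit ball. The defect in the midpoint
inequality for `‖·‖ ^ 2` has one part from the difference of the norms and one part from the
modulus of convexity, applied to `u` and `w / ‖w‖`. -/
lemma midpoint_defect_of_convexityModulus {c : ℝ} (hc0 : 0 < c) (hc1 : c ≤ 1)
    (h : ∀ ε ∈ Set.Icc (0 : ℝ) 2, ((c * ε ^ (2 : ℝ) : ℝ) : EReal) ≤ convexityModulus X ε)
    (u w : X) (hu : ‖u‖ = 1) (hw : ‖w‖ ≤ 1) :
    ‖u + w‖ ^ 2 / 4 + c / 64 * ‖u - w‖ ^ 2 ≤ (1 + ‖w‖ ^ 2) / 2 := by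
  set s := ‖w‖ with hs
  have hs0 : 0 ≤ s := norm_nonneg w
  have hη2 : ‖u - w‖ ≤ 1 + s := (norm_sub_le _ _).trans (by rw [hu])
  have hadd1 : ‖u + w‖ ≤ 1 + s := (norm_add_le _ _).trans (by rw [hu])
  rcases le_or_gt s (1 / 2) with hs2 | hs2
  · have h1 := pow_le_pow_left₀ (norm_nonneg _) hadd1 2
    have h2 := pow_le_pow_left₀ (norm_nonneg _) hη2 2
    have h3 : c / 64 * ‖u - w‖ ^ 2 ≤ 1 / 64 * (1 + s) ^ 2 := by gcongr
    nlinarith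
  have hs' : 0 < s := by linarith
  set v := s⁻¹ • w with hv
  have hv1 : ‖v‖ = 1 := norm_smul_inv_norm (𝕜 := ℝ) (norm_pos_iff.1 hs')
  have hwv : w = s • v := by rw [hv, smul_smul, mul_inv_cancel₀ hs'.ne', one_smul]
  set ε := ‖u - v‖ with hε
  have hε0 : 0 ≤ ε := norm_nonneg _
  have hε2 : ε ≤ 2 := (norm_sub_le _ _).trans (by rw [hu, hv1]; norm_num)
  have h1 : convexityModulus X ε ≤ ((1 - ‖u + v‖ / 2 : ℝ) : EReal) :=
    iInf₂_le_of_le u v (iInf_le_of_le ⟨hu, hv1, rfl⟩ le_rfl)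
  have h2 := EReal.coe_le_coe_iff.1 ((h ε ⟨hε0, hε2⟩).trans h1)
  rw [Real.rpow_two] at h2
  have hd1 : c * ε ^ 2 ≤ 1 := by have := norm_nonneg (u + v); linarith
  have hd0 : 0 ≤ c * ε ^ 2 := by positivity
  set d := c * ε ^ 2 with hd
  have h3 : ‖u + w‖ ≤ 1 + s - 2 * (s * d) := by
    have e1 : u + w = (1 - s) • u + s • (u + v) := by rw [hwv]; module
    calc ‖u + w‖ ≤ ‖(1 - s) • u‖ + ‖s • (u + v)‖ := by rw [e1]; exact norm_add_le _ _
      _ = (1 - s) + s * ‖u + v‖ := by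
        rw [norm_smul, norm_smul, hu, Real.norm_of_nonneg (by linarith),
          Real.norm_of_nonneg hs0, mul_one]
      _ ≤ (1 - s) + s * (2 - 2 * d) := by gcongr; linarith
      _ = _ := by ring
  have h4 : ‖u - w‖ ≤ ε + (1 - s) := by
    have e1 : u - w = (u - v) + (1 - s) • v := by rw [hwv]; module
    calc ‖u - w‖ ≤ ‖u - v‖ + ‖(1 - s) • v‖ := by rw [e1]; exact norm_add_le _ _
      _ = _ := by rw [norm_smul, hv1, Real.norm_of_nonneg (by linarith), mul_one]
  have h5 := pow_le_pow_left₀ (norm_nonneg _) h3 2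
  have h6 : ‖u - w‖ ^ 2 ≤ 2 * ε ^ 2 + 2 * (1 - s) ^ 2 := by
    refine (pow_le_pow_left₀ (norm_nonneg _) h4 2).trans ?_
    nlinarith [sq_nonneg (ε - (1 - s))]
  have h7 : c / 64 * ‖u - w‖ ^ 2 ≤ c / 64 * (2 * ε ^ 2 + 2 * (1 - s) ^ 2) := by gcongr
  have h8 : c * (1 - s) ^ 2 ≤ 1 * (1 - s) ^ 2 := by gcongr
  have h9 : s * d * (s * d) ≤ s * d * s := by
    gcongr
    exact mul_le_of_le_one_right hs0 hd1
  have h10 : 1 / 2 * d ≤ s * d := by gcongr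
  have h11 : c / 64 * (2 * ε ^ 2) = d / 32 := by rw [hd]; ring
  have h12 := sq_nonneg (1 - s)
  nlinarith

lemma HasConvexityPowerType.convexityConstant_ne_top (h : HasConvexityPowerType 2 X) :
    convexityConstant 2 X ≠ ⊤ := by
  obtain ⟨c₀, hc₀, h₀⟩ := h
  set c := min c₀ 1 with hc
  have hc0 : 0 < c := lt_min hc₀ one_pos
  have hmod : ∀ ε ∈ Set.Icc (0 : ℝ) 2, ((c * ε ^ (2 : ℝ) : ℝ) : EReal) ≤ convexityModulus X ε := by
    intro ε hε
    refine (EReal.coe_le_coe_iff.2 ?_).trans (h₀ ε hε)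
    gcongr
    · exact Real.rpow_nonneg hε.1 _
    · exact min_le_left _ _
  -- The inequality for arbitrary vectors follows by homogeneity.
  have hmid (u w : X) (hwu : ‖w‖ ≤ ‖u‖) :
      ‖u + w‖ ^ 2 / 4 + c / 64 * ‖u - w‖ ^ 2 ≤ (‖u‖ ^ 2 + ‖w‖ ^ 2) / 2 := by
    rcases eq_or_ne u 0 with rfl | hu
    · have : w = 0 := by simpa using hwu
      simp [this]
    have hu' : 0 < ‖u‖ := norm_pos_iff.2 hu
    have h1 := midpoint_defect_of_convexityModulus hc0 (min_le_right _ _) hmod (‖u‖⁻¹ • u)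
      (‖u‖⁻¹ • w) (norm_smul_inv_norm (𝕜 := ℝ) hu) (by
        rw [norm_smul, norm_inv, norm_norm]
        exact inv_mul_le_one_of_le₀ hwu hu'.le)
    rw [← smul_add, ← smul_sub, norm_smul, norm_smul, norm_smul, norm_inv, norm_norm,
      mul_pow, mul_pow, mul_pow] at h1
    have h2 := mul_le_mul_of_nonneg_left h1 (sq_nonneg ‖u‖)
    field_simp at h2
    linarith
  have hmid' (u w : X) :
      ‖u + w‖ ^ 2 / 4 + c / 64 * ‖u - w‖ ^ 2 ≤ (‖u‖ ^ 2 + ‖w‖ ^ 2) / 2 := by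
    rcases le_total ‖w‖ ‖u‖ with h1 | h1
    · exact hmid u w h1
    · have h2 := hmid w u h1
      rw [add_comm w, norm_sub_rev] at h2
      linarith
  refine ((convexityConstant_le (X := X) (K := √(16 / c)) (by positivity) fun x y => ?_).trans_lt
    ENNReal.ofReal_lt_top).ne
  have h1 := hmid' (x + y) (x - y)
  have e1 : x + y + (x - y) = (2 : ℝ) • x := by module
  have e2 : x + y - (x - y) = (2 : ℝ) • y := by module
  rw [e1, e2, norm_smul, norm_smul, mul_pow, mul_pow, Real.norm_ofNat] at h1
  rw [Real.sq_sqrt (by positivity), div_div_eq_mul_div]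
  linarith

theorem exists_lipschitzExtends_of_powerType {Y : Type*} [NormedAddCommGroup Y]
    [NormedSpace ℝ Y] [CompleteSpace Y] (hX : HasSmoothnessPowerType 2 X)
    (hY : HasConvexityPowerType 2 Y) : ∃ C : ℝ≥0, LipschitzExtends X Y C :=
  ⟨_, lipschitzExtends_of_constants_eq
    (ENNReal.coe_toNNReal hX.smoothnessConstant_ne_top).symm
    (ENNReal.coe_toNNReal hY.convexityConstant_ne_top).symm⟩

end Moduli

/-! ### Two-point inequalities for powers of the absolute value -/

section TwoPoint

/-- The second-order lower bound for `(1 + t) ^ q + (1 - t) ^ q`. The difference of the two sides is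
even and convex on `[-1, 1]`. -/
lemma two_add_le_rpow_add_rpow {q : ℝ} (hq1 : 1 < q) (hq2 : q ≤ 2) {t : ℝ} (ht : |t| ≤ 1) :
    2 + q * (q - 1) * t ^ 2 ≤ (1 + t) ^ q + (1 - t) ^ q := by
  set h : ℝ → ℝ := fun t => (1 + t) ^ q + (1 - t) ^ q - q * (q - 1) * t ^ 2 with hh
  have hconv : ConvexOn ℝ (Set.Icc (-1) 1) h := by
    refine convexOn_of_hasDerivWithinAt2_nonneg (convex_Icc _ _)
      (f' := fun t => q * (1 + t) ^ (q - 1) - q * (1 - t) ^ (q - 1) - q * (q - 1) * (2 * t))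
      (f'' := fun t => q * (q - 1) * ((1 + t) ^ (q - 2) + (1 - t) ^ (q - 2) - 2)) ?_ ?_ ?_ ?_
    · refine Continuous.continuousOn ?_
      have h0 : 0 ≤ q := by linarith
      exact (((continuous_const.add continuous_id).rpow_const fun _ => Or.inr h0).add
        ((continuous_const.sub continuous_id).rpow_const fun _ => Or.inr h0)).sub (by fun_prop)
    · intro t ht
      rw [interior_Icc] at ht
      have h1 : 1 + t ≠ 0 := by linarith [ht.1]
      have h2 : 1 - t ≠ 0 := by linarith [ht.2]
      have d1 := ((hasDerivAt_id t).const_add 1).rpow_const (p := q) (Or.inl h1)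
      have d2 := ((hasDerivAt_id t).const_sub 1).rpow_const (p := q) (Or.inl h2)
      have d3 := ((hasDerivAt_pow 2 t).const_mul (q * (q - 1)))
      refine (((d1.add d2).sub d3).congr_deriv ?_).hasDerivWithinAt
      simp
      ring
    · intro t ht
      rw [interior_Icc] at ht
      have h1 : 1 + t ≠ 0 := by linarith [ht.1]
      have h2 : 1 - t ≠ 0 := by linarith [ht.2]
      have d1 := (((hasDerivAt_id t).const_add 1).rpow_const (p := q - 1) (Or.inl h1)).const_mul q
      have d2 := (((hasDerivAt_id t).const_sub 1).rpow_const (p := q - 1) (Or.inl h2)).const_mul q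
      have d3 := ((hasDerivAt_id t).const_mul 2).const_mul (q * (q - 1))
      refine (((d1.sub d2).sub d3).congr_deriv ?_).hasDerivWithinAt
      have e : q - 1 - 1 = q - 2 := by ring
      simp [e]
      ring
    · intro t ht
      rw [interior_Icc] at ht
      have h1 : 0 < 1 + t := by linarith [ht.1]
      have h2 : 0 < 1 - t := by linarith [ht.2]
      have h3 : 1 ≤ (1 + t) ^ (q - 2) * (1 - t) ^ (q - 2) := by
        rw [← Real.mul_rpow h1.le h2.le]
        exact Real.one_le_rpow_of_pos_of_le_one_of_nonpos (by positivity)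
          (by nlinarith [sq_nonneg t]) (by linarith)
      have h4 := Real.rpow_pos_of_pos h1 (q - 2)
      have h5 := Real.rpow_pos_of_pos h2 (q - 2)
      have h6 : 2 ≤ (1 + t) ^ (q - 2) + (1 - t) ^ (q - 2) := by
        nlinarith [sq_nonneg ((1 + t) ^ (q - 2) - (1 - t) ^ (q - 2))]
      have h7 : 0 ≤ q * (q - 1) := mul_nonneg (by linarith) (by linarith)
      exact mul_nonneg h7 (by linarith)
  have ht' := abs_le.1 ht
  have h1 := hconv.2 (x := t) (y := -t) ht' ⟨by linarith [ht'.2], by linarith [ht'.1]⟩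
    (by norm_num : (0 : ℝ) ≤ 1 / 2) (by norm_num : (0 : ℝ) ≤ 1 / 2) (by norm_num)
  simp only [hh, smul_eq_mul] at h1
  have e1 : 1 / 2 * t + 1 / 2 * -t = 0 := by ring
  rw [e1] at h1
  norm_num at h1
  have e2 : 1 + -t = 1 - t := by ring
  rw [e2] at h1
  linarith

/-- The two-point inequality behind the `2`-convexity of `L_q`. -/
lemma rpow_le_avg_rpow {q : ℝ} (hq1 : 1 < q) (hq2 : q ≤ 2) (a b : ℝ) :
    (a ^ 2 + (q - 1) * b ^ 2) ^ (q / 2) ≤ (|a + b| ^ q + |a - b| ^ q) / 2 := by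
  have hq0 : 0 < q := by linarith
  have key (a b : ℝ) (hab : |b| ≤ |a|) :
      (a ^ 2 + (q - 1) * b ^ 2) ^ (q / 2) ≤ (|a + b| ^ q + |a - b| ^ q) / 2 := by
    rcases eq_or_ne a 0 with rfl | ha
    · have hb : b = 0 := by simpa using hab
      simp [hb, Real.zero_rpow hq0.ne', Real.zero_rpow (by positivity : q / 2 ≠ 0)]
    have ha' : 0 < |a| := abs_pos.2 ha
    set t := b / a with ht
    have hb : b = a * t := by rw [ht]; field_simp
    have ht1 : |t| ≤ 1 := by rw [ht, abs_div]; exact (div_le_one ha').2 hab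
    have ht2 := abs_le.1 ht1
    have h1 := two_add_le_rpow_add_rpow hq1 hq2 ht1
    have h0 : 0 ≤ (q - 1) * t ^ 2 := mul_nonneg (by linarith) (sq_nonneg t)
    have h2 := rpow_one_add_le_one_add_mul_self (s := (q - 1) * t ^ 2) (by linarith)
      (p := q / 2) (by positivity) (by linarith)
    have e1 : a ^ 2 + (q - 1) * b ^ 2 = |a| ^ 2 * (1 + (q - 1) * t ^ 2) := by
      rw [hb, sq_abs]; ring
    have e2 : |a + b| = |a| * (1 + t) := by
      rw [hb, show a + a * t = a * (1 + t) by ring, abs_mul,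
        abs_of_nonneg (by linarith : 0 ≤ 1 + t)]
    have e3 : |a - b| = |a| * (1 - t) := by
      rw [hb, show a - a * t = a * (1 - t) by ring, abs_mul,
        abs_of_nonneg (by linarith : 0 ≤ 1 - t)]
    have e4 : (|a| ^ 2) ^ (q / 2) = |a| ^ q := by
      rw [← Real.rpow_two, ← Real.rpow_mul ha'.le]
      congr 1
      ring
    rw [e1, e2, e3, Real.mul_rpow (by positivity) (by linarith), e4,
      Real.mul_rpow ha'.le (by linarith), Real.mul_rpow ha'.le (by linarith), ← mul_add,
      mul_div_assoc]
    gcongr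
    linarith
  rcases le_total |b| |a| with h | h
  · exact key a b h
  · have h1 := key b a h
    rw [add_comm b, abs_sub_comm b] at h1
    refine le_trans ?_ h1
    have h2 : a ^ 2 ≤ b ^ 2 := sq_le_sq.2 h
    have h3 : 0 ≤ a ^ 2 + (q - 1) * b ^ 2 :=
      add_nonneg (sq_nonneg a) (mul_nonneg (by linarith) (sq_nonneg b))
    exact Real.rpow_le_rpow h3 (by nlinarith) (by positivity)

/-- The two-point inequality behind the `2`-smoothness of `L_p`. It is dual to the one for the
conjugate exponent, applied to the even and odd parts of `u ^ (p - 1)`. -/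
lemma avg_rpow_le_rpow {p : ℝ} (hp : 2 ≤ p) (a b : ℝ) :
    (|a + b| ^ p + |a - b| ^ p) / 2 ≤ (a ^ 2 + (p - 1) * b ^ 2) ^ (p / 2) := by
  have hp1 : 0 < p - 1 := by linarith
  have hp0 : 0 < p := by linarith
  have key (u v : ℝ) (hu : 0 ≤ u) (hv : 0 ≤ v) : (u ^ p + v ^ p) / 2 ≤
      (((u + v) / 2) ^ 2 + (p - 1) * ((u - v) / 2) ^ 2) ^ (p / 2) := by
    set N := ((u + v) / 2) ^ 2 + (p - 1) * ((u - v) / 2) ^ 2 with hN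
    have hN0 : 0 ≤ N := by positivity
    set H := (u ^ p + v ^ p) / 2 with hH
    have hH0 : 0 ≤ H := by positivity
    rcases hH0.eq_or_lt with h0 | hHpos
    · rw [← h0]; positivity
    set q := p / (p - 1) with hq
    have hq1' : q - 1 = 1 / (p - 1) := by rw [hq]; field_simp; ring
    have hq1 : 1 < q := by
      have : 0 < 1 / (p - 1) := by positivity
      linarith
    have hq2 : q ≤ 2 := by rw [hq, div_le_iff₀ hp1]; linarith
    set α := (u ^ (p - 1) + v ^ (p - 1)) / 2 with hα
    set β := (u ^ (p - 1) - v ^ (p - 1)) / 2 with hβ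
    have hpow (s : ℝ) (hs : 0 ≤ s) : s * s ^ (p - 1) = s ^ p := by
      rcases hs.eq_or_lt with rfl | hs'
      · simp [Real.zero_rpow hp0.ne']
      · rw [Real.rpow_sub_one hs'.ne']; field_simp
    have hpow' (s : ℝ) (hs : 0 ≤ s) : (s ^ (p - 1)) ^ q = s ^ p := by
      rw [← Real.rpow_mul hs, hq, mul_div_cancel₀ _ hp1.ne']
    have h1 := rpow_le_avg_rpow hq1 hq2 α β
    have e1 : α + β = u ^ (p - 1) := by rw [hα, hβ]; ring
    have e2 : α - β = v ^ (p - 1) := by rw [hα, hβ]; ring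
    rw [e1, e2, abs_of_nonneg (by positivity), abs_of_nonneg (by positivity), hpow' u hu,
      hpow' v hv, ← hH] at h1
    set G := α ^ 2 + (q - 1) * β ^ 2 with hG
    have hG0 : 0 ≤ G := add_nonneg (sq_nonneg _) (mul_nonneg (by linarith) (sq_nonneg _))
    have h2 : G ≤ H ^ (2 / q) := by
      have h3 := Real.rpow_le_rpow (by positivity) h1 (by positivity : 0 ≤ 2 / q)
      rwa [← Real.rpow_mul hG0, show q / 2 * (2 / q) = 1 by field_simp, Real.rpow_one] at h3
    have h4 : H = (u + v) / 2 * α + (u - v) / 2 * β := by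
      rw [hH, ← hpow u hu, ← hpow v hv, hα, hβ]; ring
    have h5 : H ^ 2 ≤ N * G := by
      have e3 : N * G - H ^ 2 =
          ((u + v) / 2 * β - (p - 1) * ((u - v) / 2) * α) ^ 2 / (p - 1) := by
        rw [h4, hN, hG, hq1']
        field_simp
        ring
      have : 0 ≤ ((u + v) / 2 * β - (p - 1) * ((u - v) / 2) * α) ^ 2 / (p - 1) := by positivity
      linarith
    have h6 : H ^ (2 / p) * H ^ (2 / q) ≤ N * H ^ (2 / q) := by
      rw [← Real.rpow_add hHpos, show 2 / p + 2 / q = 2 by rw [hq]; field_simp; ring,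
        Real.rpow_two]
      exact h5.trans (by gcongr)
    have h7 := le_of_mul_le_mul_right h6 (by positivity)
    have h8 := Real.rpow_le_rpow (by positivity) h7 (by positivity : 0 ≤ p / 2)
    rwa [← Real.rpow_mul hH0, show 2 / p * (p / 2) = 1 by field_simp, Real.rpow_one] at h8
  have hle {M N : ℝ} (h : M ≤ N) (hM : 0 ≤ M) : M ^ (p / 2) ≤ N ^ (p / 2) :=
    Real.rpow_le_rpow hM h (by positivity)
  have h1 := key |a + b| |a - b| (abs_nonneg _) (abs_nonneg _)
  refine h1.trans (hle ?_ (by positivity))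
  -- The half-sum and half-difference of `|a + b|` and `|a - b|` are the larger and the smaller
  -- of `|a|` and `|b|`.
  have s1 : |a + b| ^ 2 = (a + b) ^ 2 := sq_abs _
  have s2 : |a - b| ^ 2 = (a - b) ^ 2 := sq_abs _
  have s3 : |a ^ 2 - b ^ 2| = |a + b| * |a - b| := by rw [← abs_mul]; congr 1; ring
  have s4 : a ^ 2 - b ^ 2 ≤ |a + b| * |a - b| := by rw [← s3]; exact le_abs_self _
  nlinarith [mul_le_mul_of_nonneg_left s4 (by linarith : 0 ≤ p - 2)]

end TwoPoint

/-! ### The constants of `L_p` -/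

section Lp

open MeasureTheory

variable {Ω : Type*} [MeasurableSpace Ω] {μ : Measure Ω} {p : ℝ}

lemma Lp_integrable_rpow (hp : 0 < p) (f : Lp ℝ (ENNReal.ofReal p) μ) :
    Integrable (fun x => |f x| ^ p) μ := by
  have h := (Lp.memLp f).integrable_norm_rpow (by simpa using hp) ENNReal.ofReal_ne_top
  simpa [ENNReal.toReal_ofReal hp.le] using h

lemma Lp_norm_rpow_eq_integral (hp : 0 < p) (f : Lp ℝ (ENNReal.ofReal p) μ) :
    ‖f‖ ^ p = ∫ x, |f x| ^ p ∂μ := by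
  have h := (Lp.memLp f).eLpNorm_eq_integral_rpow_norm (by simpa using hp) ENNReal.ofReal_ne_top
  have h0 : 0 ≤ ∫ x, |f x| ^ p ∂μ := integral_nonneg fun x => Real.rpow_nonneg (abs_nonneg _) _
  simp only [ENNReal.toReal_ofReal hp.le, Real.norm_eq_abs] at h
  rw [Lp.norm_def, h, ENNReal.toReal_ofReal (Real.rpow_nonneg h0 _), ← Real.rpow_mul h0,
    inv_mul_cancel₀ hp.ne', Real.rpow_one]

lemma Lp_integral_avg (hp : 0 < p) (f g : Lp ℝ (ENNReal.ofReal p) μ) :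
    Integrable (fun x => (|f x + g x| ^ p + |f x - g x| ^ p) / 2) μ ∧
      ∫ x, (|f x + g x| ^ p + |f x - g x| ^ p) / 2 ∂μ = (‖f + g‖ ^ p + ‖f - g‖ ^ p) / 2 := by
  have h1 := Lp_integrable_rpow hp (f + g)
  have h2 := Lp_integrable_rpow hp (f - g)
  have h3 : (fun x => (|(f + g : Lp ℝ (ENNReal.ofReal p) μ) x| ^ p +
      |(f - g : Lp ℝ (ENNReal.ofReal p) μ) x| ^ p) / 2) =ᵐ[μ]
      fun x => (|f x + g x| ^ p + |f x - g x| ^ p) / 2 := by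
    filter_upwards [Lp.coeFn_add f g, Lp.coeFn_sub f g] with x hx hx'
    rw [hx, hx']
    rfl
  refine ⟨((h1.add h2).div_const 2).congr h3, ?_⟩
  rw [← integral_congr_ae h3, integral_div, integral_add h1 h2, ← Lp_norm_rpow_eq_integral hp,
    ← Lp_norm_rpow_eq_integral hp]

/-- A two-point inequality between `p`-th powers passes from scalars to `L_p`. -/
lemma Lp_le_avg_of_forall (hp : 0 < p) {c₁ c₂ : ℝ}
    (h : ∀ a b : ℝ, c₁ * |a| ^ p + c₂ * |b| ^ p ≤ (|a + b| ^ p + |a - b| ^ p) / 2)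
    (f g : Lp ℝ (ENNReal.ofReal p) μ) :
    c₁ * ‖f‖ ^ p + c₂ * ‖g‖ ^ p ≤ (‖f + g‖ ^ p + ‖f - g‖ ^ p) / 2 := by
  obtain ⟨h1, h2⟩ := Lp_integral_avg hp f g
  have h3 := (Lp_integrable_rpow hp f).const_mul c₁
  have h4 := (Lp_integrable_rpow hp g).const_mul c₂
  rw [← h2, Lp_norm_rpow_eq_integral hp, Lp_norm_rpow_eq_integral hp, ← integral_const_mul,
    ← integral_const_mul, ← integral_add h3 h4]
  exact integral_mono (h3.add h4) h1 fun x => h _ _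

lemma Lp_avg_le_of_forall (hp : 0 < p) {c₁ c₂ : ℝ}
    (h : ∀ a b : ℝ, (|a + b| ^ p + |a - b| ^ p) / 2 ≤ c₁ * |a| ^ p + c₂ * |b| ^ p)
    (f g : Lp ℝ (ENNReal.ofReal p) μ) :
    (‖f + g‖ ^ p + ‖f - g‖ ^ p) / 2 ≤ c₁ * ‖f‖ ^ p + c₂ * ‖g‖ ^ p := by
  obtain ⟨h1, h2⟩ := Lp_integral_avg hp f g
  have h3 := (Lp_integrable_rpow hp f).const_mul c₁
  have h4 := (Lp_integrable_rpow hp g).const_mul c₂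
  rw [← h2, Lp_norm_rpow_eq_integral hp, Lp_norm_rpow_eq_integral hp, ← integral_const_mul,
    ← integral_const_mul, ← integral_add h3 h4]
  exact integral_mono h1 (h3.add h4) fun x => h _ _

/-- Homogeneity of a term of Jensen's inequality with weight `l`. It is used both for scalars `s`
and, after integration, for the norms of functions. -/
lemma weighted_rpow_eq {l c r : ℝ} (hl : 0 < l) (hc : 0 ≤ c) {s : ℝ} (hs : 0 ≤ s) :
    l * (c * s ^ 2 / l) ^ (r / 2) = l * (c / l) ^ (r / 2) * s ^ r := by
  rw [show c * s ^ 2 / l = c / l * s ^ 2 by ring, Real.mul_rpow (by positivity) (by positivity),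
    ← Real.rpow_two, ← Real.rpow_mul hs, mul_div_cancel₀ _ two_ne_zero]
  ring

variable [Fact (1 ≤ ENNReal.ofReal p)]

/-- `L_p` is `2`-smooth with constant `√(p - 1)` for `2 ≤ p`. The scalar two-point inequality,
weakened by Jensen's inequality to one between `p`-th powers, is integrated; the weights in Jensen's
inequality are chosen so that nothing is lost for the given norms. -/
lemma Lp_smooth (hp : 2 ≤ p) (f g : Lp ℝ (ENNReal.ofReal p) μ) :
    ‖f + g‖ ^ 2 + ‖f - g‖ ^ 2 ≤ 2 * ‖f‖ ^ 2 + 2 * (p - 1) * ‖g‖ ^ 2 := by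
  have hp0 : 0 < p := by linarith
  have hp1 : 0 < p - 1 := by linarith
  rcases eq_or_ne f 0 with rfl | hf
  · simp only [zero_add, zero_sub, norm_neg, norm_zero]
    nlinarith [sq_nonneg ‖g‖]
  rcases eq_or_ne g 0 with rfl | hg
  · simp [two_mul]
  have hf' := norm_pos_iff.2 hf
  have hg' := norm_pos_iff.2 hg
  have hconv := convexOn_rpow (p := p / 2) (by linarith)
  have hjensen {l m s t : ℝ} (hl : 0 < l) (hm : 0 < m) (hlm : l + m = 1) (hs : 0 ≤ s)
      (ht : 0 ≤ t) : (s + t) ^ (p / 2) ≤ l * (s / l) ^ (p / 2) + m * (t / m) ^ (p / 2) := by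
    have h := hconv.2 (x := s / l) (y := t / m) (Set.mem_Ici.2 (by positivity))
      (Set.mem_Ici.2 (by positivity)) hl.le hm.le hlm
    simpa only [smul_eq_mul, mul_div_cancel₀ _ hl.ne', mul_div_cancel₀ _ hm.ne'] using h
  set N := 1 * ‖f‖ ^ 2 + (p - 1) * ‖g‖ ^ 2 with hN
  have hN0 : 0 < N := by positivity
  -- With these weights Jensen's inequality is an equality at the pair of norms of `f` and `g`.
  set l := 1 * ‖f‖ ^ 2 / N with hl
  set m := (p - 1) * ‖g‖ ^ 2 / N with hm
  have hl0 : 0 < l := by positivity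
  have hm0 : 0 < m := by positivity
  have hlm : l + m = 1 := by rw [hl, hm, ← add_div]; exact div_self hN0.ne'
  have h1 := Lp_avg_le_of_forall hp0 (c₁ := l * (1 / l) ^ (p / 2))
    (c₂ := m * ((p - 1) / m) ^ (p / 2)) (fun a b => by
      rw [← weighted_rpow_eq hl0 zero_le_one (abs_nonneg a),
        ← weighted_rpow_eq hm0 hp1.le (abs_nonneg b), sq_abs, sq_abs, one_mul]
      exact (avg_rpow_le_rpow hp a b).trans (hjensen hl0 hm0 hlm (sq_nonneg a) (by positivity)))
    f g
  rw [← weighted_rpow_eq hl0 zero_le_one hf'.le, ← weighted_rpow_eq hm0 hp1.le hg'.le,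
    show 1 * ‖f‖ ^ 2 / l = N by rw [hl]; field_simp,
    show (p - 1) * ‖g‖ ^ 2 / m = N by rw [hm]; field_simp, ← add_mul, hlm, one_mul] at h1
  have hsq (s : ℝ) (hs : 0 ≤ s) : (s ^ 2) ^ (p / 2) = s ^ p := by
    rw [← Real.rpow_two, ← Real.rpow_mul hs, mul_div_cancel₀ _ two_ne_zero]
  have h2 := hconv.2 (x := ‖f + g‖ ^ 2) (y := ‖f - g‖ ^ 2) (Set.mem_Ici.2 (by positivity))
    (Set.mem_Ici.2 (by positivity)) (by norm_num : (0 : ℝ) ≤ 1 / 2)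
    (by norm_num : (0 : ℝ) ≤ 1 / 2) (by norm_num)
  simp only [smul_eq_mul, hsq _ (norm_nonneg _)] at h2
  have h3 := (Real.rpow_le_rpow_iff (by positivity) hN0.le (by positivity : 0 < p / 2)).1
    (h2.trans (le_trans (by linarith) h1))
  linarith

/-- `L_p` is `2`-convex with constant `1 / √(p - 1)` for `1 < p ≤ 2`; all the inequalities in the
proof of `Lp_smooth` are reversed. -/
lemma Lp_convex (hp1 : 1 < p) (hp2 : p ≤ 2) (f g : Lp ℝ (ENNReal.ofReal p) μ) :
    2 * ‖f‖ ^ 2 + 2 * (p - 1) * ‖g‖ ^ 2 ≤ ‖f + g‖ ^ 2 + ‖f - g‖ ^ 2 := by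
  have hp0 : 0 < p := by linarith
  have hp1 : 0 < p - 1 := by linarith
  rcases eq_or_ne f 0 with rfl | hf
  · simp only [zero_add, zero_sub, norm_neg, norm_zero]
    nlinarith [sq_nonneg ‖g‖]
  rcases eq_or_ne g 0 with rfl | hg
  · simp [two_mul]
  have hf' := norm_pos_iff.2 hf
  have hg' := norm_pos_iff.2 hg
  have hconc := Real.concaveOn_rpow (p := p / 2) (by linarith) (by linarith)
  have hjensen {l m s t : ℝ} (hl : 0 < l) (hm : 0 < m) (hlm : l + m = 1) (hs : 0 ≤ s)
      (ht : 0 ≤ t) : l * (s / l) ^ (p / 2) + m * (t / m) ^ (p / 2) ≤ (s + t) ^ (p / 2) := by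
    have h := hconc.2 (x := s / l) (y := t / m) (Set.mem_Ici.2 (by positivity))
      (Set.mem_Ici.2 (by positivity)) hl.le hm.le hlm
    simpa only [smul_eq_mul, mul_div_cancel₀ _ hl.ne', mul_div_cancel₀ _ hm.ne'] using h
  set N := 1 * ‖f‖ ^ 2 + (p - 1) * ‖g‖ ^ 2 with hN
  have hN0 : 0 < N := by positivity
  set l := 1 * ‖f‖ ^ 2 / N with hl
  set m := (p - 1) * ‖g‖ ^ 2 / N with hm
  have hl0 : 0 < l := by positivity
  have hm0 : 0 < m := by positivity
  have hlm : l + m = 1 := by rw [hl, hm, ← add_div]; exact div_self hN0.ne'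
  have h1 := Lp_le_avg_of_forall hp0 (c₁ := l * (1 / l) ^ (p / 2))
    (c₂ := m * ((p - 1) / m) ^ (p / 2)) (fun a b => by
      rw [← weighted_rpow_eq hl0 zero_le_one (abs_nonneg a),
        ← weighted_rpow_eq hm0 hp1.le (abs_nonneg b), sq_abs, sq_abs, one_mul]
      exact (hjensen hl0 hm0 hlm (sq_nonneg a) (by positivity)).trans
        (rpow_le_avg_rpow (by linarith) hp2 a b))
    f g
  rw [← weighted_rpow_eq hl0 zero_le_one hf'.le, ← weighted_rpow_eq hm0 hp1.le hg'.le,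
    show 1 * ‖f‖ ^ 2 / l = N by rw [hl]; field_simp,
    show (p - 1) * ‖g‖ ^ 2 / m = N by rw [hm]; field_simp, ← add_mul, hlm, one_mul] at h1
  have hsq (s : ℝ) (hs : 0 ≤ s) : (s ^ 2) ^ (p / 2) = s ^ p := by
    rw [← Real.rpow_two, ← Real.rpow_mul hs, mul_div_cancel₀ _ two_ne_zero]
  have h2 := hconc.2 (x := ‖f + g‖ ^ 2) (y := ‖f - g‖ ^ 2) (Set.mem_Ici.2 (by positivity))
    (Set.mem_Ici.2 (by positivity)) (by norm_num : (0 : ℝ) ≤ 1 / 2)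
    (by norm_num : (0 : ℝ) ≤ 1 / 2) (by norm_num)
  simp only [smul_eq_mul, hsq _ (norm_nonneg _)] at h2
  have h3 := (Real.rpow_le_rpow_iff hN0.le (by positivity) (by positivity : 0 < p / 2)).1
    (h1.trans (le_trans (by linarith) h2))
  linarith

theorem extensionConstant_Lp_le {Ω' : Type*} [MeasurableSpace Ω'] (μ : Measure Ω)
    (ν : Measure Ω') {q : ℝ} [Fact (1 ≤ ENNReal.ofReal q)] (hp : 2 ≤ p) (hq1 : 1 < q)
    (hq2 : q ≤ 2) :
    extensionConstant (Lp ℝ (ENNReal.ofReal p) μ) (Lp ℝ (ENNReal.ofReal q) ν) ≤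
      ENNReal.ofReal (24 * √((p - 1) / (q - 1))) := by
  have hp0 : 0 < p - 1 := by linarith
  have hq0 : 0 < q - 1 := by linarith
  have hS := smoothnessConstant_le (X := Lp ℝ (ENNReal.ofReal p) μ) (S := √(p - 1))
    (by positivity) fun f g => by
      rw [Real.sq_sqrt hp0.le]
      exact Lp_smooth hp f g
  have hK := convexityConstant_le (X := Lp ℝ (ENNReal.ofReal q) ν) (K := √(1 / (q - 1)))
    (by positivity) fun f g => by
      rw [Real.sq_sqrt (by positivity), div_div_eq_mul_div, div_one]
      exact Lp_convex hq1 hq2 f g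
  refine (extensionConstant_le_mul.trans (mul_le_mul' (mul_le_mul' le_rfl hS) hK)).trans_eq ?_
  rw [show (24 : ℝ≥0∞) = ENNReal.ofReal 24 by simp, ← ENNReal.ofReal_mul (by norm_num),
    ← ENNReal.ofReal_mul (by positivity), mul_assoc, ← Real.sqrt_mul hp0.le, mul_one_div]

end Lp

theorem mainTheorem2 :
    (∀ (X Y : Type*) [NormedAddCommGroup X] [NormedSpace ℝ X] [CompleteSpace X]
        [NormedAddCommGroup Y] [NormedSpace ℝ Y] [CompleteSpace Y],
      extensionConstant X Y ≤ 24 * smoothnessConstant 2 X * convexityConstant 2 Y ∧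
      (∀ S K : ℝ≥0, smoothnessConstant 2 X = S → convexityConstant 2 Y = K →
        LipschitzExtends X Y (24 * S * K)) ∧
      (HasSmoothnessPowerType 2 X → HasConvexityPowerType 2 Y →
        ∃ C : ℝ≥0, LipschitzExtends X Y C)) ∧
    (∀ (Ω Ω' : Type*) [MeasurableSpace Ω] [MeasurableSpace Ω']
        (μ : MeasureTheory.Measure Ω) (ν : MeasureTheory.Measure Ω') (p q : ℝ)
        [Fact (1 ≤ ENNReal.ofReal p)] [Fact (1 ≤ ENNReal.ofReal q)],
      2 ≤ p → 1 < q → q ≤ 2 →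
        extensionConstant (MeasureTheory.Lp ℝ (ENNReal.ofReal p) μ)
            (MeasureTheory.Lp ℝ (ENNReal.ofReal q) ν) ≤
          ENNReal.ofReal (24 * Real.sqrt ((p - 1) / (q - 1)))) := by
  refine ⟨fun X Y _ _ _ _ _ _ => ⟨extensionConstant_le_mul, fun S K hS hK =>
    lipschitzExtends_of_constants_eq hS hK, exists_lipschitzExtends_of_powerType⟩, ?_⟩
  intro Ω Ω' _ _ μ ν p q _ _ hp hq1 hq2
  exact extensionConstant_Lp_le μ ν hp hq1 hq2
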